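/- All graphs are finite and simple, and $\lg$ is the logarithm to base $2$. A biclique is a complete bipartite graph. A biclique cover of a graph $G$ is a finite set $\{B_1,\dots,B_k\}$ of bicliques with $E(G)=\bigcup_i E(B_i)$; it is a biclique partition if the sets $E(B_i)$ are pairwise disjoint. Its weight is $\sum_{i=1}^k |V(B_i)|$. Let $\mathrm{bc}(G)$ be the minimum weight of a biclique cover of $G$ and $\mathrm{bp}(G)$ the minimum weight of a biclique partition of $G$. Let $h_2(x)=-x\lg x-(1-x)\lg(1-x)$ be the binary entropy function. Theorem. Let $p\in(0,1)$ be fixed and, given $n$, let $m=m(n)=\lfloor p\binom n2\rfloor$. Let $G$ be a random graph on $n$ vertices chosen either according to $G(n,m)$ (uniformly among the $n$-vertex graphs with exactly $m$ edges) or according to $G(n,p)$ (each pair of vertices is an edge independently with probability $p$). Then, with probability tending to $1$ as $n\to\infty$, $$\mathrm{bc}(G)\sim \mathrm{bp}(G)\sim \frac{h_2(p)}{2}\cdot\frac{n^2}{\lg n},$$ where $X(G)\sim Y(G)$ with probability tending to $1$ means that for every $\varepsilon>0$ the probability that $|X(G)-Y(G)|\le\varepsilon|Y(G)|$ tends to $1$.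 Moreover, in both models the expectations satisfy, as $n\to\infty$, $$\mathbb E[\mathrm{bc}(G)]\sim\mathbb E[\mathrm{bp}(G)]\sim\frac{h_2(p)}{2}\cdot\frac{n^2}{\lg n}.$$ -/

import Mathlib

/-- A biclique (complete bipartite graph) on vertices from `V`, given by its two parts, which are
disjoint nonempty finite sets of vertices. -/
structure Biclique (V : Type*) where
  left : Finset V
  right : Finset V
  left_nonempty : left.Nonempty
  right_nonempty : right.Nonempty
  disjoint : Disjoint left right

namespace Biclique

/-- The edges of a biclique: all pairs with one endpoint in each part. -/
def graph {V : Type*} (B : Biclique V) : SimpleGraph V where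
  Adj u v := (u ∈ B.left ∧ v ∈ B.right) ∨ (u ∈ B.right ∧ v ∈ B.left)
  symm := ⟨fun _ _ h => h.elim (fun h => Or.inr ⟨h.2, h.1⟩) (fun h => Or.inl ⟨h.2, h.1⟩)⟩
  loopless := ⟨fun _ h => h.elim (fun h => Finset.disjoint_left.mp B.disjoint h.1 h.2)
    (fun h => Finset.disjoint_left.mp B.disjoint h.2 h.1)⟩

/-- The number of vertices of a biclique (its parts are disjoint). -/
def order {V : Type*} (B : Biclique V) : ℕ := B.left.card + B.right.card

end Biclique

/-- `𝓑` is a biclique cover of `G`: the union of the edge sets of its members is `E(G)`. -/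
def IsBicliqueCover {V : Type*} (G : SimpleGraph V) (𝓑 : Finset (Biclique V)) : Prop :=
  (⋃ B ∈ 𝓑, B.graph.edgeSet) = G.edgeSet

/-- `𝓑` is a biclique partition of `G`: `E(G)` is the disjoint union of the edge sets of its
members. -/
def IsBicliquePartition {V : Type*} (G : SimpleGraph V) (𝓑 : Finset (Biclique V)) : Prop :=
  IsBicliqueCover G 𝓑 ∧
    (𝓑 : Set (Biclique V)).PairwiseDisjoint (fun B => B.graph.edgeSet)

/-- The weight of a family of bicliques: the sum of the numbers of vertices of its members. -/
def bicliqueWeight {V : Type*} (𝓑 : Finset (Biclique V)) : ℕ := ∑ B ∈ 𝓑, B.order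

/-- The minimum weight of a biclique cover of `G`. -/
noncomputable def minCoverWeight {V : Type*} (G : SimpleGraph V) : ℕ :=
  sInf {w : ℕ | ∃ 𝓑 : Finset (Biclique V), IsBicliqueCover G 𝓑 ∧ bicliqueWeight 𝓑 = w}

/-- The minimum weight of a biclique partition of `G`. -/
noncomputable def minPartitionWeight {V : Type*} (G : SimpleGraph V) : ℕ :=
  sInf {w : ℕ | ∃ 𝓑 : Finset (Biclique V), IsBicliquePartition G 𝓑 ∧ bicliqueWeight 𝓑 = w}

/-- Every finite graph has a biclique partition (into single edges), so that the two infima above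
are minima over nonempty sets. -/
theorem exists_isBicliquePartition {V : Type*} [Finite V] (G : SimpleGraph V) :
    ∃ 𝓑 : Finset (Biclique V), IsBicliquePartition G 𝓑 := by
  classical
  have key : ∀ e : G.edgeSet, ∃ B : Biclique V, B.graph.edgeSet = {e.1} := by
    rintro ⟨e, he⟩
    induction e using Sym2.ind with
    | _ u v =>
      have huv : u ≠ v := G.ne_of_adj he
      refine ⟨⟨{u}, {v}, by simp, by simp, by simpa using huv⟩, ?_⟩
      ext e
      induction e using Sym2.ind with
      | _ a b => simp [Biclique.graph]
  choose f hf using key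
  have : Fintype G.edgeSet := Fintype.ofFinite _
  refine ⟨Finset.univ.image f, ?_, ?_⟩
  · unfold IsBicliqueCover
    ext e
    simp [hf]
  · intro B hB B' hB' hne
    simp only [Finset.coe_image, Finset.coe_univ, Set.image_univ, Set.mem_range] at hB hB'
    obtain ⟨e, rfl⟩ := hB
    obtain ⟨e', rfl⟩ := hB'
    have : e.1 ≠ e'.1 := fun h => hne (by rw [Subtype.ext h])
    simpa [Function.onFun, hf] using this

/-- The binary entropy function. -/
noncomputable def binaryEntropy (x : ℝ) : ℝ :=
  -x * Real.logb 2 x - (1 - x) * Real.logb 2 (1 - x)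

/-- The law of the uniform random graph `G(n, m)`: the uniform distribution on the graphs with
vertex set `Fin n` and exactly `m` edges. -/
noncomputable def uniformRandomGraph (n m : ℕ) : MeasureTheory.Measure (SimpleGraph (Fin n)) :=
  ProbabilityTheory.uniformOn {G : SimpleGraph (Fin n) | G.edgeSet.ncard = m}

/-- For a random graph `G` on `n` vertices with law `μ n`, the statement that `X(G) ∼ Y(G)` with
probability tending to `1` as `n → ∞`: for each `ε > 0`, the event
`|X(G) - Y(G)| ≤ ε |Y(G)|` has probability tending to `1`. -/
def AsymptoticWhp (μ : (n : ℕ) → MeasureTheory.Measure (SimpleGraph (Fin n)))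
    (X Y : (n : ℕ) → SimpleGraph (Fin n) → ℝ) : Prop :=
  ∀ ε : ℝ, 0 < ε → Filter.Tendsto
    (fun n : ℕ => μ n {G : SimpleGraph (Fin n) | |X n G - Y n G| ≤ ε * |Y n G|})
    Filter.atTop (nhds 1)

/-! Write H for the entropy of `p` in nats (`Real.binEntropy`) and L = H n² / (2 log n); the bases
of the logarithms cancel, so L is the claimed size. Since bc ≤ bp, a lower bound for bc and an upper
bound for bp suffice.

Lower bound: a cover of weight w is described by about w vertex names, and at most n^w · exp(e²)
graphs have such a cover (`ncard_minCoverWeight_le`). For w = (1 - ε) L this is about exp((1 - ε) H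
n² / 2), whereas a set of graphs needs about exp(H n² / 2) members to be likely in either model.
Hence bc ≥ (1 - ε) L with high probability.

Upper bound: cut the vertices into blocks of size s = c log n with c slightly below 1 / H. For each
block and each subset S of it, join S to the later vertices whose neighbourhood in the block is
exactly S (`minPartitionWeight_le_of_blocks`). A vertex lies in one such class per earlier block,
which costs n² / (2s), about L. Only about exp(H s) patterns S per block are typical, and this is a
power of n below n, so the sides S cost o(L). Edges inside blocks and edges of atypical patterns are
taken singly; a moment bound makes the latter rare in expectation. So E[bp] ≤ (1 + ε) L.

A random variable that is rarely below (1 - δ) L and has mean at most (1 + δ) L is rarely above (1 +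
ε) L, which gives concentration. `IsEntropicModel` isolates what is needed of the two random models.
-/

open Finset MeasureTheory Filter Topology

namespace Biclique

variable {V : Type*}

lemma left_right_injective : Function.Injective fun B : Biclique V => (B.left, B.right) := by
  rintro ⟨l, r, _, _, _⟩ ⟨l', r', _, _, _⟩ h
  simp only [Prod.mk.injEq] at h
  obtain ⟨rfl, rfl⟩ := h
  rfl

instance [Finite V] : Finite (Biclique V) := Finite.of_injective _ left_right_injective

lemma mk_mem_edgeSet (B : Biclique V) (u v : V) :
    s(u, v) ∈ B.graph.edgeSet ↔ (u ∈ B.left ∧ v ∈ B.right) ∨ (u ∈ B.right ∧ v ∈ B.left) :=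
  Iff.rfl

end Biclique

/-! ### Counting graphs by cover weight, and partitions from indexed families. -/

section Weights

variable {V : Type*}

lemma minCoverWeight_le {G : SimpleGraph V} {𝓑 : Finset (Biclique V)} (h : IsBicliqueCover G 𝓑) :
    minCoverWeight G ≤ bicliqueWeight 𝓑 := Nat.sInf_le ⟨𝓑, h, rfl⟩

lemma minPartitionWeight_le {G : SimpleGraph V} {𝓑 : Finset (Biclique V)}
    (h : IsBicliquePartition G 𝓑) : minPartitionWeight G ≤ bicliqueWeight 𝓑 :=
  Nat.sInf_le ⟨𝓑, h, rfl⟩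

lemma exists_weight_eq_minPartitionWeight [Finite V] (G : SimpleGraph V) :
    ∃ 𝓑 : Finset (Biclique V), IsBicliquePartition G 𝓑 ∧ bicliqueWeight 𝓑 = minPartitionWeight G :=
  Nat.sInf_mem (s := {w | ∃ 𝓑, IsBicliquePartition G 𝓑 ∧ bicliqueWeight 𝓑 = w})
    (let ⟨𝓑, h⟩ := exists_isBicliquePartition G; ⟨_, 𝓑, h, rfl⟩)

lemma exists_weight_eq_minCoverWeight [Finite V] (G : SimpleGraph V) :
    ∃ 𝓑 : Finset (Biclique V), IsBicliqueCover G 𝓑 ∧ bicliqueWeight 𝓑 = minCoverWeight G :=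
  Nat.sInf_mem (s := {w | ∃ 𝓑, IsBicliqueCover G 𝓑 ∧ bicliqueWeight 𝓑 = w})
    (let ⟨𝓑, h⟩ := exists_isBicliquePartition G; ⟨_, 𝓑, h.1, rfl⟩)

lemma minCoverWeight_le_minPartitionWeight [Finite V] (G : SimpleGraph V) :
    minCoverWeight G ≤ minPartitionWeight G := by
  obtain ⟨𝓑, h, hw⟩ := exists_weight_eq_minPartitionWeight G
  exact hw ▸ minCoverWeight_le h.1

/-- The number of graphs with a biclique cover of weight at most `w`. -/
lemma ncard_minCoverWeight_le [Fintype V] [Nonempty V] (w : ℕ) :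
    ({G : SimpleGraph V | minCoverWeight G ≤ w}.ncard : ℝ) ≤
      (Fintype.card V : ℝ) ^ w * Real.exp (Real.exp 2) := by
  classical
  have := Fintype.ofFinite (Biclique V)
  set n := Fintype.card V with hn
  have hn0 : 0 < n := Fintype.card_pos
  -- Families are counted by the generating function of their weight, evaluated at `x = 1 / n`: a
  -- family of weight at most `w` contributes at least `x ^ w`, and the sum over all families
  -- factorises over bicliques.
  set x : ℝ := (n : ℝ)⁻¹ with hx
  have hx0 : 0 < x := by positivity
  have hx1 : x ≤ 1 := inv_le_one_of_one_le₀ (by exact_mod_cast hn0)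
  set F : Finset (Finset (Biclique V)) := {𝓑 | bicliqueWeight 𝓑 ≤ w} with hF
  have h1 : {G : SimpleGraph V | minCoverWeight G ≤ w}.ncard ≤ F.card := by
    have hsub : {G : SimpleGraph V | minCoverWeight G ≤ w} ⊆
        (fun 𝓑 : Finset (Biclique V) =>
          SimpleGraph.fromEdgeSet (⋃ B ∈ 𝓑, B.graph.edgeSet)) '' (F : Set _) := by
      intro G hG
      obtain ⟨𝓑, h, hw⟩ := exists_weight_eq_minCoverWeight G
      refine ⟨𝓑, by simpa [hF, hw] using hG, ?_⟩
      simp only [IsBicliqueCover] at h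
      simp only [h, SimpleGraph.fromEdgeSet_edgeSet]
    refine (Set.ncard_le_ncard hsub (Set.toFinite _)).trans ?_
    exact (Set.ncard_image_le (Set.toFinite _)).trans (Set.ncard_coe_finset F).le
  have hprod : ∀ 𝓑 : Finset (Biclique V), ∏ B ∈ 𝓑, x ^ B.order = x ^ bicliqueWeight 𝓑 := by
    intro 𝓑; rw [bicliqueWeight, prod_pow_eq_pow_sum]
  have h2 : (F.card : ℝ) * x ^ w ≤ ∏ B : Biclique V, (1 + x ^ B.order) := by
    rw [prod_one_add]
    calc (F.card : ℝ) * x ^ w = ∑ _𝓑 ∈ F, x ^ w := by simp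
      _ ≤ ∑ 𝓑 ∈ F, ∏ B ∈ 𝓑, x ^ B.order := by
        refine sum_le_sum fun 𝓑 h𝓑 => ?_
        rw [hprod]
        exact pow_le_pow_of_le_one hx0.le hx1 (by simpa [hF] using h𝓑)
      _ ≤ _ := sum_le_sum_of_subset_of_nonneg (by simp)
        fun 𝓑 _ _ => prod_nonneg fun _ _ => by positivity
  -- Bicliques inject into pairs of vertex sets, over which the sum is (1 + 1/n)^(2n).
  have h3 : ∑ B : Biclique V, x ^ B.order ≤ Real.exp 2 := by
    calc ∑ B : Biclique V, x ^ B.order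
        = ∑ P ∈ univ.image (fun B : Biclique V => (B.left, B.right)),
            x ^ P.1.card * x ^ P.2.card := by
          rw [sum_image (Biclique.left_right_injective.injOn)]
          simp [Biclique.order, pow_add]
      _ ≤ ∑ P : Finset V × Finset V, x ^ P.1.card * x ^ P.2.card :=
          sum_le_sum_of_subset_of_nonneg (subset_univ _) fun _ _ _ => by positivity
      _ = (x + 1) ^ n * (x + 1) ^ n := by
          have := Fintype.sum_pow_mul_eq_add_pow V x (1 : ℝ)
          simp only [one_pow, mul_one] at this
          rw [hn, ← this, Fintype.sum_prod_type, sum_mul_sum]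
      _ ≤ Real.exp x ^ n * Real.exp x ^ n := by
          have := Real.add_one_le_exp x
          gcongr
      _ = Real.exp 2 := by
          rw [← Real.exp_nat_mul, ← Real.exp_add]
          congr 1
          rw [hx]; field_simp; norm_num
  have h4 : ∏ B : Biclique V, (1 + x ^ B.order) ≤ Real.exp (Real.exp 2) :=
    (Real.prod_one_add_le_exp_sum _ fun _ => by positivity).trans (Real.exp_le_exp.2 h3)
  have h5 : (F.card : ℝ) ≤ (n : ℝ) ^ w * Real.exp (Real.exp 2) := by
    have := h2.trans h4
    rw [hx, inv_pow, ← div_eq_mul_inv, div_le_iff₀ (by positivity)] at this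
    linarith
  exact le_trans (by exact_mod_cast h1) h5

/-- A family of complete bipartite pieces covering each edge exactly once bounds the minimum weight
of a biclique partition, even if some pieces are empty. -/
lemma minPartitionWeight_le_of_family {ι : Type*} (G : SimpleGraph V) (I : Finset ι)
    (L R : ι → Finset V) (hadj : ∀ i ∈ I, ∀ u ∈ L i, ∀ v ∈ R i, G.Adj u v)
    (hcover : ∀ u v, G.Adj u v → ∃ i ∈ I, (u ∈ L i ∧ v ∈ R i) ∨ (u ∈ R i ∧ v ∈ L i))
    (huniq : ∀ i ∈ I, ∀ j ∈ I, ∀ u ∈ L i, ∀ v ∈ R i,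
      (u ∈ L j ∧ v ∈ R j) ∨ (u ∈ R j ∧ v ∈ L j) → i = j) :
    minPartitionWeight G ≤ ∑ i ∈ I, ((L i).card + (R i).card) := by
  classical
  -- Pieces with an empty side contain no edge; dropping them only lowers the weight.
  set I' : Finset ι := {i ∈ I | (L i).Nonempty ∧ (R i).Nonempty} with hI'
  have hmem : ∀ i ∈ I', i ∈ I ∧ (L i).Nonempty ∧ (R i).Nonempty := fun i hi => by
    simpa [hI'] using hi
  let f : I' → Biclique V := fun i =>
    ⟨L i, R i, (hmem i i.2).2.1, (hmem i i.2).2.2, Finset.disjoint_left.2 fun u hu hu' =>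
      G.loopless.irrefl u (hadj i (hmem i i.2).1 u hu u hu')⟩
  have hpart : IsBicliquePartition G (univ.image f) := by
    constructor
    · unfold IsBicliqueCover
      ext e
      induction e using Sym2.ind with
      | _ u v =>
        simp only [Set.mem_iUnion, exists_prop, mem_image, mem_univ,
          true_and, exists_exists_eq_and, SimpleGraph.mem_edgeSet]
        constructor
        · rintro ⟨i, hi | hi⟩
          · exact hadj i (hmem i i.2).1 u hi.1 v hi.2
          · exact (hadj i (hmem i i.2).1 v hi.2 u hi.1).symm
        · intro h
          obtain ⟨i, hi, hi'⟩ := hcover u v h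
          refine ⟨⟨i, ?_⟩, hi'⟩
          simp only [hI', mem_filter, hi, true_and]
          rcases hi' with h | h
          · exact ⟨⟨u, h.1⟩, ⟨v, h.2⟩⟩
          · exact ⟨⟨v, h.2⟩, ⟨u, h.1⟩⟩
    · intro B hB B' hB' hne
      simp only [coe_image, coe_univ, Set.image_univ, Set.mem_range] at hB hB'
      obtain ⟨i, rfl⟩ := hB
      obtain ⟨j, rfl⟩ := hB'
      rw [Function.onFun, Set.disjoint_left]
      intro e
      induction e using Sym2.ind with
      | _ u v =>
        rw [Biclique.mk_mem_edgeSet, Biclique.mk_mem_edgeSet]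
        rintro (hi | hi) hj
        · exact hne (congrArg f (Subtype.ext
            (huniq i (hmem i i.2).1 j (hmem j j.2).1 u hi.1 v hi.2 hj)))
        · refine hne (congrArg f (Subtype.ext
            (huniq i (hmem i i.2).1 j (hmem j j.2).1 v hi.2 u hi.1 ?_)))
          exact hj.symm.imp And.symm And.symm
  calc minPartitionWeight G ≤ bicliqueWeight (univ.image f) := minPartitionWeight_le hpart
    _ ≤ ∑ i : I', (f i).order := sum_image_le_of_nonneg (fun _ _ => Nat.zero_le _)
    _ = ∑ i ∈ I', ((L i).card + (R i).card) := by
        rw [← sum_attach I']; rfl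
    _ ≤ _ := sum_le_sum_of_subset (filter_subset _ _)

end Weights

/-! ### The block construction of a biclique partition. -/

section Blocks

/-- The `j`-th block of `s` consecutive vertices. -/
def vertexBlock (n s j : ℕ) : Finset (Fin n) := {u | (u : ℕ) / s = j}

@[simp] lemma mem_vertexBlock {n s j : ℕ} {u : Fin n} : u ∈ vertexBlock n s j ↔ (u : ℕ) / s = j := by
  simp [vertexBlock]

lemma card_vertexBlock_le (n s j : ℕ) (hs : 0 < s) : (vertexBlock n s j).card ≤ s := by
  have h : (vertexBlock n s j).map Fin.valEmbedding ⊆ Ico (j * s) (j * s + s) := by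
    intro x hx
    obtain ⟨u, hu, rfl⟩ := Finset.mem_map.1 hx
    rw [mem_vertexBlock, Nat.div_eq_iff hs] at hu
    simp only [Fin.valEmbedding_apply, mem_Ico]
    omega
  simpa using card_le_card h

/-- A shorter remainder block can only have index `n / s`, the last one, so every block that
precedes some vertex's block is full. -/
lemma card_vertexBlock {n s j : ℕ} (hs : 0 < s) (hj : j < n / s) : (vertexBlock n s j).card = s := by
  have h : (vertexBlock n s j).map Fin.valEmbedding = Ico (j * s) (j * s + s) := by
    have hjn : (j + 1) * s ≤ n := (Nat.mul_le_mul_right s hj).trans (Nat.div_mul_le_self n s)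
    rw [add_one_mul] at hjn
    ext x
    simp only [Finset.mem_map, mem_vertexBlock, Fin.valEmbedding_apply, mem_Ico, Nat.div_eq_iff hs]
    constructor
    · rintro ⟨u, hu, rfl⟩; omega
    · intro hx; exact ⟨⟨x, by omega⟩, by simp only; omega, rfl⟩
  rw [← card_map Fin.valEmbedding, h]; simp

open Classical in
/-- The set of neighbours of `v` inside `B`. -/
noncomputable def neighborsIn {V : Type*} (G : SimpleGraph V) (B : Finset V) (v : V) : Finset V :=
  {u ∈ B | G.Adj v u}

lemma mem_neighborsIn {V : Type*} {G : SimpleGraph V} {B : Finset V} {u v : V} :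
    u ∈ neighborsIn G B v ↔ u ∈ B ∧ G.Adj v u := by
  classical
  simp [neighborsIn]

lemma neighborsIn_subset {V : Type*} (G : SimpleGraph V) (B : Finset V) (v : V) :
    neighborsIn G B v ⊆ B :=
  fun _ hu => (mem_neighborsIn.1 hu).1

open Classical in
/-- Pairs of a vertex and an earlier block for which the neighbourhood of the vertex in the block
fails the predicate `T`. -/
noncomputable def exceptionalPairs {n : ℕ} (s : ℕ) (T : Finset (Fin n) → Prop)
    (G : SimpleGraph (Fin n)) : Finset (Fin n × ℕ) :=
  {x ∈ univ ×ˢ range (n / s) | x.2 < (x.1 : ℕ) / s ∧ ¬ T (neighborsIn G (vertexBlock n s x.2) x.1)}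

open Classical in
/-- Grouping the vertices by their neighbourhoods in each earlier block bounds the minimum weight
of a biclique partition. -/
lemma minPartitionWeight_le_of_blocks {n s : ℕ} (hs : 0 < s) (T : Finset (Fin n) → Prop)
    (G : SimpleGraph (Fin n)) :
    minPartitionWeight G ≤ ∑ v : Fin n, (v : ℕ) / s +
      s * ∑ j ∈ range (n / s), #{S ∈ (vertexBlock n s j).powerset | T S} +
      2 * (n * s + s * (exceptionalPairs s T G).card) := by
  -- The index `(j, S)` stands for the piece joining a pattern `S` in block `j` to the later
  -- vertices that see exactly `S` there.
  let A : Finset (ℕ × Finset (Fin n)) :=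
    (range (n / s)).biUnion fun j =>
      {S ∈ (vertexBlock n s j).powerset | T S}.map (Function.Embedding.sectR j _)
  have hA : ∀ j S, (j, S) ∈ A ↔ j < n / s ∧ S ⊆ vertexBlock n s j ∧ T S := by
    intro j S; simp [A]
  -- The remaining edges, each its own piece: those inside a block and those whose pattern fails
  -- `T`.
  let E : Finset (Fin n × Fin n) :=
    {x | G.Adj x.1 x.2 ∧ x.1 < x.2 ∧ ((x.1 : ℕ) / s = (x.2 : ℕ) / s ∨
      ¬ T (neighborsIn G (vertexBlock n s ((x.1 : ℕ) / s)) x.2))}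
  have hE : ∀ u v, (u, v) ∈ E ↔ G.Adj u v ∧ u < v ∧ ((u : ℕ) / s = (v : ℕ) / s ∨
      ¬ T (neighborsIn G (vertexBlock n s ((u : ℕ) / s)) v)) := by
    intro u v; simp [E]
  let rows : ℕ × Finset (Fin n) → Finset (Fin n) := fun x =>
    {v | x.1 < (v : ℕ) / s ∧ neighborsIn G (vertexBlock n s x.1) v = x.2}
  have hrows : ∀ j S v, v ∈ rows (j, S) ↔
      j < (v : ℕ) / s ∧ neighborsIn G (vertexBlock n s j) v = S := by
    intro j S v; simp [rows]
  have hdivlt : ∀ v : Fin n, (v : ℕ) / s ≤ n / s := fun v => Nat.div_le_div_right v.2.le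
  have key := minPartitionWeight_le_of_family G (A.disjSum E)
    (Sum.elim rows fun x => {x.1}) (Sum.elim Prod.snd fun x => {x.2}) ?_ ?_ ?_
  rotate_left
  · rintro (⟨j, S⟩ | ⟨u, v⟩) hi a ha b hb
    · simp only [Sum.elim_inl, hrows] at ha hb
      rw [← ha.2, mem_neighborsIn] at hb
      exact hb.2
    · simp only [Sum.elim_inr, mem_singleton] at ha hb
      subst ha hb
      rw [inr_mem_disjSum, hE] at hi
      exact hi.1
  · intro u v huv
    wlog huv' : u < v generalizing u v
    · have huv'' : v < u := lt_of_le_of_ne (not_lt.1 huv') huv.ne'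
      obtain ⟨i, hi, h⟩ := this v u huv.symm huv''
      exact ⟨i, hi, h.symm.imp And.symm And.symm⟩
    by_cases h : (u : ℕ) / s = (v : ℕ) / s ∨
      ¬ T (neighborsIn G (vertexBlock n s ((u : ℕ) / s)) v)
    · exact ⟨.inr (u, v), by rw [inr_mem_disjSum, hE]; exact ⟨huv, huv', h⟩, by simp⟩
    · push Not at h
      have hlt : (u : ℕ) / s < (v : ℕ) / s :=
        lt_of_le_of_ne (Nat.div_le_div_right (Fin.lt_def.1 huv').le) h.1
      refine ⟨.inl ((u : ℕ) / s, neighborsIn G (vertexBlock n s ((u : ℕ) / s)) v), ?_, ?_⟩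
      · rw [inl_mem_disjSum, hA]
        exact ⟨hlt.trans_le (hdivlt v), neighborsIn_subset _ _ _, h.2⟩
      · right
        simp only [Sum.elim_inl, hrows, mem_neighborsIn, mem_vertexBlock]
        exact ⟨⟨trivial, huv.symm⟩, hlt, trivial⟩
  -- An edge recovers its piece: the earlier endpoint gives the block `j`, and the neighbourhood of
  -- the later one in that block gives `S`.
  · have hAA : ∀ j S v u, (j, S) ∈ A → v ∈ rows (j, S) → u ∈ S →
        (u : ℕ) / s = j ∧ j < (v : ℕ) / s ∧
          neighborsIn G (vertexBlock n s j) v = S ∧ T S := by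
      intro j S v u hi hv hu
      rw [hA] at hi
      rw [hrows] at hv
      exact ⟨mem_vertexBlock.1 (hi.2.1 hu), hv.1, hv.2, hi.2.2⟩
    rintro (⟨j, S⟩ | ⟨a, b⟩) hi (⟨j', S'⟩ | ⟨a', b'⟩) hi' u hu v hv h <;>
      simp only [inl_mem_disjSum, inr_mem_disjSum, Sum.elim_inl, Sum.elim_inr, mem_singleton] at *
    · obtain ⟨h1, h2, h3, -⟩ := hAA j S u v hi hu hv
      rcases h with h | h
      · obtain ⟨h1', h2', h3', -⟩ := hAA j' S' u v hi' h.1 h.2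
        obtain rfl : j = j' := by omega
        rw [← h3, ← h3']
      · obtain ⟨h1', h2', h3', -⟩ := hAA j' S' v u hi' h.2 h.1
        omega
    · obtain ⟨h1, h2, h3, h4⟩ := hAA j S u v hi hu hv
      rw [hE] at hi'
      rcases h with ⟨rfl, rfl⟩ | ⟨rfl, rfl⟩
      · have := Nat.div_le_div_right (c := s) (Fin.lt_def.1 hi'.2.1).le
        omega
      · rcases hi'.2.2 with h | h
        · omega
        · rw [h1, h3] at h; exact absurd h4 h
    · subst hu hv
      rw [hE] at hi
      rcases h with h | h
      · obtain ⟨h1, h2, -⟩ := hAA j' S' u v hi' h.1 h.2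
        have := Nat.div_le_div_right (c := s) (Fin.lt_def.1 hi.2.1).le
        omega
      · obtain ⟨h1, h2, h3, h4⟩ := hAA j' S' v u hi' h.2 h.1
        rcases hi.2.2 with h | h
        · omega
        · rw [h1, h3] at h; exact absurd h4 h
    · subst hu hv
      rw [hE] at hi hi'
      rcases h with ⟨rfl, rfl⟩ | ⟨rfl, rfl⟩
      · rfl
      · exact absurd (hi.2.1.trans hi'.2.1) (lt_irrefl _)
  refine key.trans ?_
  rw [sum_disjSum]
  simp only [Sum.elim_inl, Sum.elim_inr, card_singleton, sum_add_distrib]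
  have hAsum : ∀ f : ℕ × Finset (Fin n) → ℕ, ∑ x ∈ A, f x =
      ∑ j ∈ range (n / s), ∑ S ∈ (vertexBlock n s j).powerset with T S, f (j, S) := by
    intro f
    rw [sum_biUnion]
    · simp
    · intro j _ j' _ hne
      rw [Function.onFun, Finset.disjoint_left]
      rintro ⟨a, S⟩ h h'
      simp only [Finset.mem_map, Function.Embedding.sectR_apply, Prod.mk.injEq] at h h'
      obtain ⟨_, _, h, _⟩ := h
      obtain ⟨_, _, h', _⟩ := h'
      exact hne (h.trans h'.symm)
  -- For fixed `j` the classes are disjoint, so `v` is counted at most once for each of its `v / s`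
  -- earlier blocks.
  have c1 : ∑ x ∈ A, #(rows x) ≤ ∑ v : Fin n, (v : ℕ) / s := by
    rw [hAsum]
    calc _ ≤ ∑ j ∈ range (n / s), #{v : Fin n | j < (v : ℕ) / s} := by
          refine sum_le_sum fun j hj => ?_
          rw [← card_biUnion]
          · refine card_le_card fun v hv => ?_
            simp only [mem_biUnion] at hv
            obtain ⟨S, _, hv⟩ := hv
            simpa using ((hrows _ _ _).1 hv).1
          · intro S _ S' _ hne
            refine Finset.disjoint_left.2 fun v hv hv' => ?_
            exact hne (((hrows _ _ _).1 hv).2.symm.trans ((hrows _ _ _).1 hv').2)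
      _ = ∑ v : Fin n, #{j ∈ range (n / s) | j < (v : ℕ) / s} := by
          simp only [card_filter]
          exact sum_comm
      _ ≤ _ := by
          refine sum_le_sum fun v _ => ?_
          refine (card_le_card (t := range ((v : ℕ) / s)) fun j hj => ?_).trans (card_range _).le
          exact mem_range.2 (mem_filter.1 hj).2
  have c2 : ∑ x ∈ A, #x.2 ≤
      s * ∑ j ∈ range (n / s), #{S ∈ (vertexBlock n s j).powerset | T S} := by
    rw [hAsum, mul_sum]
    refine sum_le_sum fun j _ => ?_
    rw [mul_comm, ← smul_eq_mul]
    refine sum_le_card_nsmul _ _ _ fun S hS => ?_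
    exact (card_le_card (mem_powerset.1 (mem_filter.1 hS).1)).trans (card_vertexBlock_le _ _ _ hs)
  have c3 : #E ≤ n * s + s * #(exceptionalPairs s T G) := by
    have hsub : E ⊆ (univ.biUnion fun v : Fin n =>
          (vertexBlock n s ((v : ℕ) / s)).map (Function.Embedding.sectL _ v)) ∪
        (exceptionalPairs s T G).biUnion fun x =>
          (vertexBlock n s x.2).map (Function.Embedding.sectL _ x.1) := by
      rintro ⟨u, v⟩ h
      rw [hE] at h
      by_cases huv : (u : ℕ) / s = (v : ℕ) / s
      · simp [huv]
      · have hlt : (u : ℕ) / s < (v : ℕ) / s :=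
          lt_of_le_of_ne (Nat.div_le_div_right (Fin.lt_def.1 h.2.1).le) huv
        refine mem_union_right _ (mem_biUnion.2 ⟨(v, (u : ℕ) / s), ?_, by simp⟩)
        simp only [exceptionalPairs, mem_filter, mem_product, mem_univ, true_and, mem_range]
        exact ⟨hlt.trans_le (hdivlt v), hlt, h.2.2.resolve_left huv⟩
    refine (card_le_card hsub).trans ((card_union_le _ _).trans (add_le_add ?_ ?_))
    · refine (card_biUnion_le_card_mul _ _ s fun v _ => ?_).trans (by simp)
      rw [card_map]; exact card_vertexBlock_le _ _ _ hs
    · refine (card_biUnion_le_card_mul _ _ s fun v _ => ?_).trans (by rw [mul_comm])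
      rw [card_map]; exact card_vertexBlock_le _ _ _ hs
  simp only [sum_const, smul_eq_mul, mul_one]
  linarith

end Blocks

/-! ### Exponential tilting around the entropy. -/

section EntropyMoments

/-- The function equals 1 at 0, so the sign of its derivative there tells on which side of 0 it
drops below 1: to the right if `a` is below the entropy, to the left if `a` is above it. This
replaces a law of large numbers for the log-likelihood. -/
lemma hasDerivAt_rpow_add_rpow_mul_exp {p : ℝ} (hp0 : 0 < p) (hp1 : p < 1) (a : ℝ) :
    HasDerivAt (fun t : ℝ => (p ^ (1 + t) + (1 - p) ^ (1 + t)) * Real.exp (t * a))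
      (a - Real.binEntropy p) 0 := by
  have hq : 0 < 1 - p := by linarith
  have h1 : ∀ {x : ℝ}, 0 < x → HasDerivAt (fun t : ℝ => x ^ (1 + t)) (Real.log x * x) 0 := by
    intro x hx
    have := ((hasDerivAt_id (0 : ℝ)).const_add 1).const_rpow hx
    simpa using this
  have h2 : HasDerivAt (fun t : ℝ => Real.exp (t * a)) a 0 := by
    have := ((hasDerivAt_id (0 : ℝ)).mul_const a).exp
    simpa using this
  have := ((h1 hp0).add (h1 hq)).mul h2
  refine this.congr_deriv ?_
  simp only [Real.binEntropy, Real.log_inv, zero_mul, Real.exp_zero, add_zero, Real.rpow_one,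
    Pi.add_apply]
  ring

lemma exists_pos_moment_lt_one {p : ℝ} (hp0 : 0 < p) (hp1 : p < 1) {ε : ℝ} (hε : 0 < ε) :
    ∃ t > 0, (p ^ (1 + t) + (1 - p) ^ (1 + t)) * Real.exp (t * (Real.binEntropy p - ε)) < 1 := by
  have h := hasDerivAt_rpow_add_rpow_mul_exp hp0 hp1 (Real.binEntropy p - ε)
  have h' := (hasDerivAt_iff_tendsto_slope.1 h).mono_left
    (nhdsWithin_mono 0 fun t (ht : 0 < t) => ht.ne' : 𝓝[>] (0 : ℝ) ≤ 𝓝[≠] 0)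
  have := (h'.eventually_lt_const (u := 0) (by linarith)).and self_mem_nhdsWithin
  obtain ⟨t, ht, ht0⟩ := this.exists
  refine ⟨t, ht0, ?_⟩
  rw [slope_def_field, div_neg_iff] at ht
  have ht0' : (0 : ℝ) < t := ht0
  rcases ht with h | h
  · linarith [h.2]
  · have := h.1
    simp only [add_zero, Real.rpow_one, zero_mul, Real.exp_zero, mul_one] at this
    linarith

lemma exists_neg_moment_lt_one {p : ℝ} (hp0 : 0 < p) (hp1 : p < 1) {ε : ℝ} (hε : 0 < ε) :
    ∃ t > 0, (p ^ (1 - t) + (1 - p) ^ (1 - t)) * Real.exp (-t * (Real.binEntropy p + ε)) < 1 := by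
  have h := hasDerivAt_rpow_add_rpow_mul_exp hp0 hp1 (Real.binEntropy p + ε)
  have h' := (hasDerivAt_iff_tendsto_slope.1 h).mono_left
    (nhdsWithin_mono 0 fun t (ht : t < 0) => ht.ne : 𝓝[<] (0 : ℝ) ≤ 𝓝[≠] 0)
  have := (h'.eventually_const_lt (u := 0) (by linarith)).and self_mem_nhdsWithin
  obtain ⟨t, ht, ht0⟩ := this.exists
  have ht0' : t < 0 := ht0
  refine ⟨-t, by simpa using ht0', ?_⟩
  rw [slope_def_field, div_pos_iff] at ht
  rw [sub_neg_eq_add, neg_neg]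
  rcases ht with h | h
  · linarith [h.2]
  · have := h.1
    simp only [add_zero, Real.rpow_one, zero_mul, Real.exp_zero, mul_one] at this
    linarith

lemma pow_mul_pow_rpow {p : ℝ} (hp0 : 0 < p) (hp1 : p < 1) (a b : ℕ) (t : ℝ) :
    (p ^ a * (1 - p) ^ b) ^ t = (p ^ t) ^ a * ((1 - p) ^ t) ^ b := by
  have hq : 0 < 1 - p := by linarith
  rw [Real.mul_rpow (by positivity) (by positivity), ← Real.rpow_natCast, ← Real.rpow_natCast,
    ← Real.rpow_mul hp0.le, ← Real.rpow_mul hq.le, mul_comm (a : ℝ), mul_comm (b : ℝ),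
    Real.rpow_mul hp0.le, Real.rpow_mul hq.le, Real.rpow_natCast, Real.rpow_natCast]

variable {α : Type*}

/-- The number of subsets of probability at least `y`. -/
lemma card_le_of_pow_mul_pow_ge {p : ℝ} (hp0 : 0 < p) (hp1 : p < 1) (B : Finset α) {y : ℝ}
    (hy : 0 < y) (T : Finset (Finset α))
    (hT : ∀ S ∈ T, S ⊆ B ∧ y ≤ p ^ #S * (1 - p) ^ (#B - #S)) : (#T : ℝ) ≤ y⁻¹ := by
  have hq : 0 < 1 - p := by linarith
  rw [← one_div, le_div_iff₀ hy]
  calc (#T : ℝ) * y = ∑ _S ∈ T, y := by simp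
    _ ≤ ∑ S ∈ T, p ^ #S * (1 - p) ^ (#B - #S) := sum_le_sum fun S hS => (hT S hS).2
    _ ≤ ∑ S ∈ B.powerset, p ^ #S * (1 - p) ^ (#B - #S) :=
        sum_le_sum_of_subset_of_nonneg (fun S hS => mem_powerset.2 (hT S hS).1)
          fun _ _ _ => by positivity
    _ = 1 := by rw [sum_pow_mul_eq_add_pow]; simp

/-- The total probability of the subsets of probability less than `y`. -/
lemma sum_le_of_pow_mul_pow_lt {p : ℝ} (hp0 : 0 < p) (hp1 : p < 1) (B : Finset α) {y t : ℝ}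
    (hy : 0 < y) (ht : 0 ≤ t) (T : Finset (Finset α))
    (hT : ∀ S ∈ T, S ⊆ B ∧ p ^ #S * (1 - p) ^ (#B - #S) < y) :
    ∑ S ∈ T, p ^ #S * (1 - p) ^ (#B - #S) ≤ (p ^ (1 - t) + (1 - p) ^ (1 - t)) ^ #B * y ^ t := by
  have hq : 0 < 1 - p := by linarith
  rw [← sum_pow_mul_eq_add_pow, sum_mul]
  refine (sum_le_sum fun S hS => ?_).trans
    (sum_le_sum_of_subset_of_nonneg (fun S hS => mem_powerset.2 (hT S hS).1)
      fun _ _ _ => by positivity)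
  rw [← pow_mul_pow_rpow hp0 hp1]
  set x := p ^ #S * (1 - p) ^ (#B - #S) with hx
  have hx0 : 0 < x := by positivity
  -- Markov's inequality for a negative power of the probability: `x ^ t ≤ y ^ t` is paid, and the
  -- sum of `x ^ (1 - t)` over all subsets factorises.
  calc x = x ^ (1 - t) * x ^ t := by rw [← Real.rpow_add hx0]; simp
    _ ≤ _ := by
      have := Real.rpow_le_rpow hx0.le (hT S hS).2.le ht
      gcongr

end EntropyMoments

/-! ### Ratios and entropy estimates of binomial coefficients. -/

section ChooseBounds

/-- Iterates the absorption identity C(a+b, a) (a+b+1) = C(a+b+1, a+1) (a+1), bounding all factors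
on the left below and on the right above by the extreme ones. -/
lemma choose_mul_pow_le (a b k : ℕ) :
    (a + b).choose a * (a + b) ^ k ≤ (a + k + b).choose (a + k) * (a + k) ^ k := by
  induction k generalizing a with
  | zero => simp
  | succ k ih =>
    have h1 : (a + b).choose a * (a + b + 1) = (a + b + 1).choose (a + 1) * (a + 1) := by
      rw [mul_comm, Nat.add_one_mul_choose_eq]
    have h2 := ih (a + 1)
    have e1 : a + 1 + b = a + b + 1 := by ring
    have e2 : a + 1 + k = a + (k + 1) := by ring
    rw [e1, e2] at h2
    calc (a + b).choose a * (a + b) ^ (k + 1)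
        = (a + b) ^ k * ((a + b).choose a * (a + b)) := by ring
      _ ≤ (a + b + 1) ^ k * ((a + b).choose a * (a + b + 1)) :=
          Nat.mul_le_mul (Nat.pow_le_pow_left (by omega) k) (Nat.mul_le_mul_left _ (by omega))
      _ = ((a + b + 1).choose (a + 1) * (a + b + 1) ^ k) * (a + 1) := by rw [h1]; ring
      _ ≤ ((a + (k + 1) + b).choose (a + (k + 1)) * (a + (k + 1)) ^ k) * (a + (k + 1)) := by
          exact Nat.mul_le_mul h2 (by omega)
      _ = _ := by ring

lemma choose_mul_pow_add_le (a b k l : ℕ) :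
    (a + b).choose a * (a + b) ^ (k + l) ≤
      (a + k + (b + l)).choose (a + k) * ((a + k) ^ k * (b + l) ^ l) := by
  have h1 := choose_mul_pow_le a b k
  have h2 := choose_mul_pow_le b (a + k) l
  have e1 : (b + (a + k)).choose b = (a + k + b).choose (a + k) := by
    rw [add_comm b, Nat.choose_symm_add]
  have e2 : (b + l + (a + k)).choose (b + l) = (a + k + (b + l)).choose (a + k) := by
    rw [add_comm (b + l), Nat.choose_symm_add]
  rw [e1, e2] at h2
  calc (a + b).choose a * (a + b) ^ (k + l)
      = ((a + b).choose a * (a + b) ^ k) * (a + b) ^ l := by ring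
    _ ≤ ((a + k + b).choose (a + k) * (a + k) ^ k) * (b + (a + k)) ^ l :=
        Nat.mul_le_mul h1 (Nat.pow_le_pow_left (by omega) l)
    _ = ((a + k + b).choose (a + k) * (b + (a + k)) ^ l) * (a + k) ^ k := by ring
    _ ≤ _ := by
      calc _ ≤ _ := Nat.mul_le_mul_right _ h2
        _ = _ := by ring

/-- Comparison of hypergeometric with binomial probabilities. -/
lemma choose_sub_le {p : ℝ} (hp0 : 0 < p) (hp1 : p < 1) {N m k l : ℕ} (hm : (m : ℝ) ≤ p * N)
    (hm' : p * N ≤ m + 1) (hk : k ≤ m) (hlt : k + l < N)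
    (hN : 2 * (k + l : ℕ) * ((1 - p) * (k + l : ℕ) + 1) ≤ (1 - p) * (N - (k + l : ℕ))) :
    ((N - (k + l)).choose (m - k) : ℝ) ≤ 2 * (p ^ k * (1 - p) ^ l) * N.choose m := by
  have hq : 0 < 1 - p := by linarith
  set s := k + l with hs
  have hNs : (0 : ℝ) < N - s := by rw [sub_pos]; exact_mod_cast hlt
  have hN0 : (0 : ℝ) < N := by have : (0:ℝ) ≤ s := by positivity
                               linarith
  by_cases hl : m + l ≤ N
  swap
  · rw [Nat.choose_eq_zero_of_lt (by omega)]; push_cast; positivity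
  have key := choose_mul_pow_add_le (m - k) (N - m - l) k l
  rw [show m - k + (N - m - l) = N - s by omega, show m - k + k = m by omega,
    show N - m - l + l = N - m by omega, show m + (N - m) = N by omega, ← hs] at key
  have key' : ((N - s).choose (m - k) : ℝ) * ((N : ℝ) - s) ^ s ≤
      N.choose m * ((m : ℝ) ^ k * ((N : ℝ) - m) ^ l) := by
    have : (((N - s).choose (m - k) * (N - s) ^ s : ℕ) : ℝ) ≤
      ((N.choose m * (m ^ k * (N - m) ^ l) : ℕ) : ℝ) := by exact_mod_cast key
    push_cast [Nat.cast_sub hlt.le, Nat.cast_sub (by omega : m ≤ N)] at this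
    exact this
  have hNm : (0 : ℝ) ≤ N - m := by rw [sub_nonneg]; exact_mod_cast (by omega : m ≤ N)
  -- Chosen so that (1 - p)(1 + x)(N - s) = (1 - p) N + 1, where the 1 absorbs the rounding of `m`.
  -- Hypothesis `hN` says exactly that `s * x ≤ 1 / 2`, so the total error (1 + x)^s is at most 2.
  set x : ℝ := ((1 - p) * s + 1) / ((1 - p) * (N - s)) with hx
  have hx0 : 0 ≤ x := by positivity
  have b1 : (m : ℝ) ≤ p * ((1 + x) * (N - s)) := by
    refine hm.trans (mul_le_mul_of_nonneg_left ?_ hp0.le)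
    have : x * (N - s) = s + (1 - p)⁻¹ := by rw [hx]; field_simp
    rw [add_mul, this]
    have : 0 < (1 - p)⁻¹ := by positivity
    linarith
  have b2 : (N : ℝ) - m ≤ (1 - p) * ((1 + x) * (N - s)) := by
    have : (1 - p) * ((1 + x) * (N - s)) = (1 - p) * N + 1 := by rw [hx]; field_simp; ring
    rw [this]; linarith
  have b3 : (1 + x) ^ s ≤ 2 := by
    calc (1 + x) ^ s ≤ Real.exp x ^ s := by
          have := Real.add_one_le_exp x
          gcongr; linarith
      _ = Real.exp (s * x) := by rw [← Real.exp_nat_mul]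
      _ ≤ Real.exp (1 / 2) := by
          refine Real.exp_le_exp.2 ?_
          rw [hx, ← mul_div_assoc, div_le_iff₀ (by positivity)]
          linarith
      _ ≤ 2 := by
          have := Real.exp_one_lt_d9
          have h2 : Real.exp (1 / 2) * Real.exp (1 / 2) = Real.exp 1 := by
            rw [← Real.exp_add]; norm_num
          nlinarith [Real.exp_pos (1 / 2)]
  have hfin : ((N - s).choose (m - k) : ℝ) * ((N : ℝ) - s) ^ s ≤
      (2 * (p ^ k * (1 - p) ^ l) * N.choose m) * ((N : ℝ) - s) ^ s := by
    refine key'.trans ?_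
    calc (N.choose m : ℝ) * ((m : ℝ) ^ k * ((N : ℝ) - m) ^ l)
        ≤ N.choose m * ((p * ((1 + x) * (N - s))) ^ k * ((1 - p) * ((1 + x) * (N - s))) ^ l) := by
          gcongr
      _ = (N.choose m * (p ^ k * (1 - p) ^ l) * (N - s) ^ s) * (1 + x) ^ s := by
          rw [hs]; simp only [mul_pow, pow_add]; ring
      _ ≤ (N.choose m * (p ^ k * (1 - p) ^ l) * (N - s) ^ s) * 2 := by gcongr
      _ = _ := by ring
  exact le_of_mul_le_mul_right hfin (by positivity)

lemma log_factorial_le (n : ℕ) (hn : n ≠ 0) :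
    Real.log n.factorial ≤ n * Real.log n - n + Real.log n + 1 := by
  induction n, Nat.one_le_iff_ne_zero.2 hn using Nat.le_induction with
  | base => simp
  | succ n hn1 ih =>
    have ih := ih (by omega)
    have hn0 : (0 : ℝ) < n := by exact_mod_cast hn1
    rw [Nat.factorial_succ]
    push_cast
    rw [Real.log_mul (by positivity) (by positivity)]
    have h : 1 - (1 + 1 / (n : ℝ))⁻¹ ≤ Real.log (1 + 1 / n) :=
      Real.one_sub_inv_le_log_of_pos (by positivity)
    have h1 : 1 + 1 / (n : ℝ) = (n + 1) / n := by field_simp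
    rw [h1, Real.log_div (by positivity) (by positivity)] at h
    have h2 : ((n : ℝ) + 1) * (1 - (((n : ℝ) + 1) / n)⁻¹) = 1 := by field_simp; ring
    have h3 := mul_le_mul_of_nonneg_left h (by positivity : (0 : ℝ) ≤ n + 1)
    rw [h2] at h3
    linarith

lemma le_log_factorial (n : ℕ) (hn : n ≠ 0) : n * Real.log n - n ≤ Real.log n.factorial := by
  have := Stirling.le_log_factorial_stirling hn
  have h1 : 0 ≤ Real.log n := Real.log_natCast_nonneg n
  have h2 : 0 ≤ Real.log (2 * Real.pi) := Real.log_nonneg (by linarith [Real.pi_gt_three])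
  linarith

/-- The loss 2 log N + 2 comes from the upper bounds for the two factorials in the denominator. -/
lemma binEntropy_mul_le_log_choose {N m : ℕ} (hm : 0 < m) (hmN : m < N) :
    N * Real.binEntropy (m / N) - 2 * Real.log N - 2 ≤ Real.log (N.choose m) := by
  obtain ⟨k, rfl⟩ : ∃ k, N = m + k := ⟨N - m, by omega⟩
  have hk : 0 < k := by omega
  have hm0 : (0 : ℝ) < m := by exact_mod_cast hm
  have hk0 : (0 : ℝ) < k := by exact_mod_cast hk
  have h1 := log_factorial_le m hm.ne'
  have h2 := log_factorial_le k hk.ne'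
  have h3 := le_log_factorial (m + k) (by omega)
  have hch : Real.log ((m + k).choose m) =
      Real.log (m + k).factorial - Real.log m.factorial - Real.log k.factorial := by
    have h := Nat.choose_mul_factorial_mul_factorial (Nat.le_add_right m k)
    rw [Nat.add_sub_cancel_left] at h
    have hpos : (0 : ℝ) < (m + k).choose m := by exact_mod_cast Nat.choose_pos (by omega)
    rw [← h]
    push_cast
    rw [Real.log_mul (by positivity) (by positivity), Real.log_mul (by positivity) (by positivity)]
    ring
  have h4 : Real.log m ≤ Real.log (m + k) := Real.log_le_log hm0 (by linarith)
  have h5 : Real.log k ≤ Real.log (m + k) := Real.log_le_log hk0 (by linarith)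
  have h6 : (1 : ℝ) - m / (m + k) = k / (m + k) := by field_simp; ring
  have h7 : ((m : ℝ) + k) * Real.binEntropy (m / (m + k)) =
      (m + k) * Real.log (m + k) - m * Real.log m - k * Real.log k := by
    rw [Real.binEntropy, h6, Real.log_inv, Real.log_inv, Real.log_div (by positivity) (by positivity),
      Real.log_div (by positivity) (by positivity)]
    field_simp
    ring
  push_cast at h3 ⊢
  rw [h7, hch]
  linarith

lemma eventually_exp_le_choose {p : ℝ} (hp0 : 0 < p) (hp1 : p < 1) {ε : ℝ} (hε : 0 < ε) :
    ∀ᶠ N : ℕ in atTop, Real.exp ((Real.binEntropy p - ε) * N) ≤ N.choose ⌊p * N⌋₊ := by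
  have hfl : Tendsto (fun N : ℕ => ((⌊p * (N : ℝ)⌋₊ : ℕ) : ℝ) / N) atTop (𝓝 p) :=
    (tendsto_nat_floor_mul_div_atTop hp0.le).comp tendsto_natCast_atTop_atTop
  have hent := (Real.binEntropy_continuous.tendsto p).comp hfl
  have hlog : Tendsto (fun N : ℕ => (2 * Real.log N + 2) / N) atTop (𝓝 0) := by
    have h1 : Tendsto (fun x : ℝ => (2 * Real.log x + 2) / x) atTop (𝓝 0) := by
      have := ((Real.isLittleO_log_id_atTop.const_mul_left 2).add
        (Asymptotics.isLittleO_const_id_atTop (2 : ℝ))).tendsto_div_nhds_zero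
      simpa using this
    exact h1.comp tendsto_natCast_atTop_atTop
  have hpos : ∀ᶠ N : ℕ in atTop, 0 < ⌊p * (N : ℝ)⌋₊ := by
    have : Tendsto (fun N : ℕ => p * (N : ℝ)) atTop atTop :=
      tendsto_natCast_atTop_atTop.const_mul_atTop hp0
    filter_upwards [this.eventually_ge_atTop 1] with N hN
    exact Nat.floor_pos.2 hN
  filter_upwards [(hent.sub hlog).eventually_const_lt
    (show Real.binEntropy p - ε < Real.binEntropy p - 0 by linarith), hpos, eventually_gt_atTop 0]
    with N h1 h2 h3
  have hN : (0 : ℝ) < N := by exact_mod_cast h3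
  have hlt : ⌊p * (N : ℝ)⌋₊ < N := by
    rw [Nat.floor_lt (by positivity)]
    nlinarith
  have h4 := binEntropy_mul_le_log_choose h2 hlt
  have hc : (0 : ℝ) < N.choose ⌊p * N⌋₊ := by exact_mod_cast Nat.choose_pos hlt.le
  rw [← Real.le_log_iff_exp_le hc]
  refine le_trans ?_ h4
  have h5 := mul_le_mul_of_nonneg_right h1.le hN.le
  simp only [Function.comp_apply, sub_mul, div_mul_cancel₀ _ hN.ne'] at h5
  linarith

end ChooseBounds

/-! ### Edge counts and pattern probabilities in the two models. -/

section RandomGraphs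

variable {V : Type*}

/-- For finite `V` this makes every set of graphs measurable, so probabilities are finite sums over
single graphs. -/
instance [Countable V] : MeasurableSingletonClass (SimpleGraph V) where
  measurableSet_singleton G := by
    have : ({G} : Set (SimpleGraph V)) = SimpleGraph.edgeSet ⁻¹' {G.edgeSet} := by
      ext H; simp
    rw [this]
    exact SimpleGraph.measurable_edgeSet (measurableSet_singleton _)

/-- The edges of a finite graph, as a finset. -/
noncomputable def edgesOf [Finite V] (G : SimpleGraph V) : Finset (Sym2 V) :=
  (Set.toFinite G.edgeSet).toFinset

@[simp] lemma mem_edgesOf [Finite V] {G : SimpleGraph V} {e : Sym2 V} :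
    e ∈ edgesOf G ↔ e ∈ G.edgeSet := by simp [edgesOf]

lemma card_edgesOf [Finite V] (G : SimpleGraph V) : #(edgesOf G) = G.edgeSet.ncard :=
  (Set.ncard_eq_toFinset_card _ _).symm

lemma card_filter_not_isDiag [Fintype V] [DecidableEq V] :
    #{e : Sym2 V | ¬ e.IsDiag} = (Fintype.card V).choose 2 := by
  rw [← Sym2.card_subtype_not_diag, Fintype.card_subtype]

/-- Once the edges within `F` are fixed, a graph is determined by its edges among the other pairs.
The weight `f` of the edge number serves both models: a product of powers for the binomial one, an
indicator for the uniform one. -/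
lemma sum_edgesOf_inter_eq_le [Fintype V] [DecidableEq V] (F K : Finset (Sym2 V)) (hF : ∀ e ∈ F, ¬ e.IsDiag)
    (f : ℕ → ℝ) (hf : ∀ i, 0 ≤ f i) :
    ∑ G : SimpleGraph V with edgesOf G ∩ F = K, f G.edgeSet.ncard ≤
      ∑ j ∈ range ((Fintype.card V).choose 2 - #F + 1),
        ((Fintype.card V).choose 2 - #F).choose j * f (j + #K) := by
  set U : Finset (Sym2 V) := {e | ¬ e.IsDiag} with hU
  have hFU : F ⊆ U := fun e he => by simpa [hU] using hF e he
  have hcard : #(U \ F) = (Fintype.card V).choose 2 - #F := by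
    rw [card_sdiff_of_subset hFU, hU, card_filter_not_isDiag]
  have h1 := sum_powerset_apply_card (fun j => f (j + #K)) (x := U \ F)
  simp only [nsmul_eq_mul, hcard] at h1
  rw [← h1]
  have hinj : Set.InjOn (fun G : SimpleGraph V => edgesOf G \ F)
      ({G : SimpleGraph V | edgesOf G ∩ F = K} : Finset _) := by
    intro G hG H hH h
    simp only [coe_filter, mem_univ, true_and, Set.mem_ofPred_eq] at hG hH h
    have : edgesOf G = edgesOf H := by
      rw [← sdiff_union_inter (edgesOf G) F, ← sdiff_union_inter (edgesOf H) F, h, hG, hH]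
    refine SimpleGraph.edgeSet_injective (Set.ext fun e => ?_)
    rw [← mem_edgesOf, this, mem_edgesOf]
  calc _ = ∑ G : SimpleGraph V with edgesOf G ∩ F = K, f (#(edgesOf G \ F) + #K) := by
        refine sum_congr rfl fun G hG => ?_
        rw [← card_edgesOf, ← (mem_filter.1 hG).2, card_sdiff_add_card_inter]
    _ = ∑ T ∈ ({G : SimpleGraph V | edgesOf G ∩ F = K} : Finset _).image (fun G => edgesOf G \ F),
          f (#T + #K) := by rw [sum_image hinj]
    _ ≤ _ := by
        refine sum_le_sum_of_subset_of_nonneg (fun T hT => ?_) fun _ _ _ => hf _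
        obtain ⟨G, _, rfl⟩ := mem_image.1 hT
        refine mem_powerset.2 (sdiff_subset_sdiff (fun e he => ?_) le_rfl)
        simpa [hU] using G.not_isDiag_of_mem_edgeSet (mem_edgesOf.1 he)

lemma sum_ncard_edgeSet_le [Fintype V] [DecidableEq V] (f : ℕ → ℝ) (hf : ∀ i, 0 ≤ f i) :
    ∑ G : SimpleGraph V, f G.edgeSet.ncard ≤
      ∑ j ∈ range ((Fintype.card V).choose 2 + 1), ((Fintype.card V).choose 2).choose j * f j := by
  simpa using sum_edgesOf_inter_eq_le (V := V) ∅ ∅ (by simp) f hf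

lemma sum_neighborsIn_eq_le [Fintype V] [DecidableEq V] {v : V} {B S : Finset V} (hv : v ∉ B)
    (f : ℕ → ℝ) (hf : ∀ i, 0 ≤ f i) :
    ∑ G : SimpleGraph V with neighborsIn G B v = S, f G.edgeSet.ncard ≤
      ∑ j ∈ range ((Fintype.card V).choose 2 - #B + 1),
        ((Fintype.card V).choose 2 - #B).choose j * f (j + #S) := by
  have hinj : Function.Injective fun u => s(v, u) := fun _ _ h => Sym2.congr_right.1 h
  have h := sum_edgesOf_inter_eq_le (B.image fun u => s(v, u)) (S.image fun u => s(v, u)) ?_ f hf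
  · rw [card_image_of_injective _ hinj, card_image_of_injective _ hinj] at h
    refine le_trans (sum_le_sum_of_subset_of_nonneg (fun G hG => ?_) fun _ _ _ => hf _) h
    simp only [mem_filter, mem_univ, true_and] at hG ⊢
    ext e
    simp only [← hG, mem_inter, mem_edgesOf, mem_image, mem_neighborsIn]
    constructor
    · rintro ⟨he, u, hu, rfl⟩
      exact ⟨u, ⟨hu, he⟩, rfl⟩
    · rintro ⟨u, ⟨hu, he⟩, rfl⟩
      exact ⟨he, u, hu, rfl⟩
  · intro e he
    obtain ⟨u, hu, rfl⟩ := mem_image.1 he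
    rw [Sym2.mk_isDiag_iff]
    rintro rfl
    exact hv hu

lemma measureReal_setOf_eq_sum [Fintype V] [DecidableEq V] (μ : Measure (SimpleGraph V)) [IsFiniteMeasure μ]
    (P : SimpleGraph V → Prop) [DecidablePred P] :
    μ.real {G | P G} = ∑ G : SimpleGraph V with P G, μ.real {G} := by
  rw [sum_measureReal_singleton]
  simp

/-! ### The binomial model. -/

section Binomial

variable [Fintype V] {p : ℝ} (hp0 : 0 < p) (hp1 : p < 1)

lemma binomialRandom_real_singleton (G : SimpleGraph V) :
    (SimpleGraph.binomialRandom V ⟨p, hp0.le, hp1.le⟩).real {G} =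
      p ^ G.edgeSet.ncard * (1 - p) ^ ((Fintype.card V).choose 2 - G.edgeSet.ncard) := by
  rw [Measure.real, SimpleGraph.binomialRandom_singleton]
  simp [Nat.card_eq_fintype_card]

lemma binomialRandom_real_neighborsIn_le {v : V} {B S : Finset V} (hv : v ∉ B) (hS : S ⊆ B)
    (hB : #B ≤ (Fintype.card V).choose 2) :
    (SimpleGraph.binomialRandom V ⟨p, hp0.le, hp1.le⟩).real {G | neighborsIn G B v = S} ≤
      p ^ #S * (1 - p) ^ (#B - #S) := by
  classical
  have hq : 0 < 1 - p := by linarith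
  rw [measureReal_setOf_eq_sum]
  simp only [binomialRandom_real_singleton hp0 hp1]
  set N := (Fintype.card V).choose 2 with hN
  refine (sum_neighborsIn_eq_le hv (fun e => p ^ e * (1 - p) ^ (N - e))
    fun _ => by positivity).trans_eq ?_
  have hSB := card_le_card hS
  have h : ∑ j ∈ range (N - #B + 1), p ^ j * (1 - p) ^ (N - #B - j) * (N - #B).choose j = 1 := by
    rw [← add_pow, add_sub_cancel, one_pow]
  refine Eq.trans ?_ ((congrArg (p ^ #S * (1 - p) ^ (#B - #S) * ·) h).trans (mul_one _))
  rw [mul_sum, ← hN]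
  refine sum_congr rfl fun j hj => ?_
  have hj' : j ≤ N - #B := by simpa [Nat.lt_succ_iff] using hj
  have e1 : N - (j + #S) = (#B - #S) + (N - #B - j) := by omega
  rw [e1, pow_add, pow_add]
  ring

lemma binomialRandom_real_le {ε t : ℝ} (ht : 0 < t) (P : SimpleGraph V → Prop) :
    (SimpleGraph.binomialRandom V ⟨p, hp0.le, hp1.le⟩).real {G | P G} ≤
      {G : SimpleGraph V | P G}.ncard *
        Real.exp (-(Real.binEntropy p - ε) * (Fintype.card V).choose 2) +
      ((p ^ (1 + t) + (1 - p) ^ (1 + t)) * Real.exp (t * (Real.binEntropy p - ε))) ^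
        (Fintype.card V).choose 2 := by
  classical
  have hq : 0 < 1 - p := by linarith
  rw [measureReal_setOf_eq_sum]
  set w := fun G => (SimpleGraph.binomialRandom V ⟨p, hp0.le, hp1.le⟩).real {G} with hw
  set N := (Fintype.card V).choose 2 with hN
  set y := Real.exp (-(Real.binEntropy p - ε) * N) with hy
  have hwpos : ∀ G, 0 < w G := fun G => by
    rw [hw]; simp only [binomialRandom_real_singleton hp0 hp1]; positivity
  -- A graph of probability at most `y` is charged to the cardinality of the event. For any other
  -- graph (w / y)^t ≥ 1, and the sum of w^(1 + t) over all graphs factorises into a power tending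
  -- to 0 for suitable `t`.
  have hpt : ∀ G, w G ≤ y + w G ^ (1 + t) * Real.exp (t * (Real.binEntropy p - ε)) ^ N := by
    intro G
    have e1 : Real.exp (t * (Real.binEntropy p - ε)) ^ N = y⁻¹ ^ t := by
      rw [hy, ← Real.exp_nat_mul, ← Real.exp_neg, ← Real.exp_mul]
      congr 1; ring
    rw [e1]
    have hy0 : 0 < y := Real.exp_pos _
    by_cases h : w G ≤ y
    · have := Real.rpow_nonneg (hwpos G).le (1 + t)
      have := Real.rpow_nonneg (inv_nonneg.2 hy0.le) t
      nlinarith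
    · push Not at h
      have h1 : w G ^ (1 + t) * y⁻¹ ^ t = w G * (w G * y⁻¹) ^ t := by
        rw [Real.rpow_add (hwpos G), Real.rpow_one, Real.mul_rpow (hwpos G).le (by positivity)]
        ring
      have h2 : 1 ≤ (w G * y⁻¹) ^ t :=
        Real.one_le_rpow (by rw [← div_eq_mul_inv, one_le_div hy0]; exact h.le) ht.le
      rw [h1]
      nlinarith [hwpos G]
  calc ∑ G : SimpleGraph V with P G, w G
      ≤ ∑ G : SimpleGraph V with P G,
          (y + w G ^ (1 + t) * Real.exp (t * (Real.binEntropy p - ε)) ^ N) :=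
        sum_le_sum fun G _ => hpt G
    _ = #{G : SimpleGraph V | P G} * y + (∑ G : SimpleGraph V with P G, w G ^ (1 + t)) *
          Real.exp (t * (Real.binEntropy p - ε)) ^ N := by
        rw [sum_add_distrib, ← sum_mul]; simp
    _ ≤ _ := by
        refine add_le_add (le_of_eq ?_) ?_
        · rw [← Set.ncard_coe_finset]; simp
        rw [mul_pow]
        refine mul_le_mul_of_nonneg_right ?_ (by positivity)
        calc ∑ G : SimpleGraph V with P G, w G ^ (1 + t) ≤ ∑ G, w G ^ (1 + t) :=
              sum_le_sum_of_subset_of_nonneg (subset_univ _)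
                fun G _ _ => Real.rpow_nonneg (hwpos G).le _
          _ = ∑ G : SimpleGraph V, (fun e : ℕ => (p ^ (1 + t)) ^ e * ((1 - p) ^ (1 + t)) ^ (N - e))
                G.edgeSet.ncard := by
              refine sum_congr rfl fun G _ => ?_
              rw [hw]
              simp only [binomialRandom_real_singleton hp0 hp1]
              rw [pow_mul_pow_rpow hp0 hp1]
          _ ≤ _ := sum_ncard_edgeSet_le
              (fun e : ℕ => (p ^ (1 + t)) ^ e * ((1 - p) ^ (1 + t)) ^ (N - e)) fun _ => by positivity
          _ = _ := by
              rw [add_pow]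
              exact sum_congr rfl fun j _ => by ring

end Binomial

/-! ### The uniform model. -/

section Uniform

lemma choose_le_ncard_setOf_ncard_edgeSet [Fintype V] (m : ℕ) :
    ((Fintype.card V).choose 2).choose m ≤ {G : SimpleGraph V | G.edgeSet.ncard = m}.ncard := by
  classical
  set U : Finset (Sym2 V) := {e | ¬ e.IsDiag} with hU
  have hedge : ∀ T ∈ powersetCard m U,
      (SimpleGraph.fromEdgeSet (T : Set (Sym2 V))).edgeSet = T := by
    intro T hT
    rw [SimpleGraph.edgeSet_fromEdgeSet, sdiff_eq_left, Set.disjoint_left]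
    intro e he
    have := (mem_powersetCard.1 hT).1 he
    simpa [hU] using this
  rw [← card_filter_not_isDiag, ← hU, ← card_powersetCard, ← Set.ncard_coe_finset]
  refine Set.ncard_le_ncard_of_injOn (fun T => SimpleGraph.fromEdgeSet (T : Set (Sym2 V))) ?_ ?_
    (Set.toFinite _)
  · intro T hT
    simp only [Set.mem_ofPred_eq]
    rw [hedge T hT, Set.ncard_coe_finset, (mem_powersetCard.1 hT).2]
  · intro T hT T' hT' h
    have := congrArg SimpleGraph.edgeSet h
    rw [hedge T hT, hedge T' hT'] at this
    exact_mod_cast this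

lemma uniformRandomGraph_real_setOf (n m : ℕ) (P : SimpleGraph (Fin n) → Prop) :
    (uniformRandomGraph n m).real {G | P G} =
      {G : SimpleGraph (Fin n) | G.edgeSet.ncard = m ∧ P G}.ncard /
        {G : SimpleGraph (Fin n) | G.edgeSet.ncard = m}.ncard := by
  classical
  have h := ProbabilityTheory.uniformOn_apply_finset
    (s := ({G : SimpleGraph (Fin n) | G.edgeSet.ncard = m} : Finset (SimpleGraph (Fin n))))
    (t := ({G : SimpleGraph (Fin n) | P G} : Finset (SimpleGraph (Fin n))))
  rw [← filter_and] at h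
  rw [← Set.ncard_coe_finset, ← Set.ncard_coe_finset] at h
  simp only [coe_filter, mem_univ, true_and] at h
  rw [uniformRandomGraph, Measure.real, h]
  simp

lemma uniformRandomGraph_real_le {n m : ℕ} (hm : m ≤ n.choose 2) (P : SimpleGraph (Fin n) → Prop) :
    (uniformRandomGraph n m).real {G | P G} ≤
      {G : SimpleGraph (Fin n) | G.edgeSet.ncard = m ∧ P G}.ncard / (n.choose 2).choose m := by
  rw [uniformRandomGraph_real_setOf]
  have h := choose_le_ncard_setOf_ncard_edgeSet (V := Fin n) m
  rw [Fintype.card_fin] at h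
  have : 0 < (n.choose 2).choose m := Nat.choose_pos hm
  gcongr

lemma isProbabilityMeasure_uniformRandomGraph {n m : ℕ} (hm : m ≤ n.choose 2) :
    IsProbabilityMeasure (uniformRandomGraph n m) := by
  refine ProbabilityTheory.isProbabilityMeasure_uniformOn (Set.toFinite _) ?_
  rw [← Set.ncard_pos]
  have h := choose_le_ncard_setOf_ncard_edgeSet (V := Fin n) m
  rw [Fintype.card_fin] at h
  exact (Nat.choose_pos hm).trans_le h

lemma uniformRandomGraph_real_neighborsIn_le {p : ℝ} (hp0 : 0 < p) (hp1 : p < 1) {n : ℕ} {v : Fin n}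
    {B S : Finset (Fin n)} (hv : v ∉ B) (hS : S ⊆ B) (hlt : #B < n.choose 2)
    (hN : 2 * #B * ((1 - p) * #B + 1) ≤ (1 - p) * (n.choose 2 - #B)) :
    (uniformRandomGraph n ⌊p * (n.choose 2 : ℝ)⌋₊).real {G | neighborsIn G B v = S} ≤
      2 * (p ^ #S * (1 - p) ^ (#B - #S)) := by
  classical
  set N := n.choose 2 with hNdef
  set m := ⌊p * (N : ℝ)⌋₊ with hmdef
  have hq : 0 < 1 - p := by linarith
  have hm : (m : ℝ) ≤ p * N := Nat.floor_le (by positivity)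
  have hm' : p * N ≤ m + 1 := (Nat.lt_floor_add_one _).le
  have hmN : m ≤ N := by
    have : (m : ℝ) ≤ N := hm.trans (mul_le_of_le_one_left (by positivity) hp1.le)
    exact_mod_cast this
  have hSB := card_le_card hS
  refine (uniformRandomGraph_real_le hmN _).trans ?_
  rw [div_le_iff₀ (by exact_mod_cast Nat.choose_pos hmN)]
  have h := sum_neighborsIn_eq_le (S := S) hv (fun e => if e = m then 1 else 0)
    (fun _ => by positivity)
  rw [← sum_filter, sum_const, nsmul_one, filter_filter, Fintype.card_fin, ← hNdef,
    ← Set.ncard_coe_finset] at h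
  simp only [coe_filter, mem_univ, true_and, and_comm (a := neighborsIn _ _ _ = _)] at h
  refine h.trans ?_
  -- If `S` has more than `m` elements, no graph with `m` edges shows the pattern; otherwise only `j
  -- = m - #S` further edges are possible.
  by_cases hSm : #S ≤ m
  · have := choose_sub_le (N := N) (m := m) (k := #S) (l := #B - #S) hp0 hp1 hm hm' hSm
      (by omega) (by rw [Nat.add_sub_cancel' hSB]; exact hN)
    rw [Nat.add_sub_cancel' hSB] at this
    refine le_trans ?_ this
    calc _ ≤ ∑ j ∈ range (N - #B + 1), if j = m - #S then ((N - #B).choose (m - #S) : ℝ) else 0 := by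
          refine sum_le_sum fun j _ => ?_
          by_cases hj : j = m - #S
          · subst hj; simp [Nat.sub_add_cancel hSm]
          · rw [if_neg hj, if_neg (by omega)]; simp
      _ ≤ _ := by
          rw [sum_ite_eq']
          split_ifs
          · exact le_rfl
          · positivity
  · rw [sum_eq_zero]
    · positivity
    · intro j _
      rw [if_neg (by omega), mul_zero]

end Uniform

end RandomGraphs

/-! ### The expected weight of the block partition. -/

section Expectation

lemma integrable_of_simpleGraph {V : Type*} [Finite V] (μ : Measure (SimpleGraph V))
    [IsFiniteMeasure μ] (f : SimpleGraph V → ℝ) : Integrable f μ := by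
  classical
  have := Fintype.ofFinite V
  exact Integrable.of_finite

/-- A neighbourhood pattern `S` in a block of size `s` is `y`-typical when its binomial probability
is at least `y`. -/
def IsTypical {V : Type*} (p y : ℝ) (s : ℕ) (S : Finset V) : Prop :=
  y ≤ p ^ #S * (1 - p) ^ (s - #S)

lemma measureReal_not_isTypical_le {V : Type*} [Fintype V] {μ : Measure (SimpleGraph V)}
    [IsFiniteMeasure μ] {p : ℝ} (hp0 : 0 < p) (hp1 : p < 1) {v : V} {B : Finset V}
    (hμ : ∀ S ⊆ B, μ.real {G | neighborsIn G B v = S} ≤ 2 * (p ^ #S * (1 - p) ^ (#B - #S)))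
    {y t : ℝ} (hy : 0 < y) (ht : 0 ≤ t) :
    μ.real {G | ¬ IsTypical p y #B (neighborsIn G B v)} ≤
      2 * ((p ^ (1 - t) + (1 - p) ^ (1 - t)) ^ #B * y ^ t) := by
  classical
  set T : Finset (Finset V) := {S ∈ B.powerset | ¬ IsTypical p y #B S} with hT
  have hsub : {G | ¬ IsTypical p y #B (neighborsIn G B v)} ⊆
      ⋃ S ∈ T, {G | neighborsIn G B v = S} := by
    intro G hG
    simp only [Set.mem_iUnion]
    exact ⟨_, mem_filter.2 ⟨mem_powerset.2 (neighborsIn_subset G B v), hG⟩, rfl⟩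
  calc _ ≤ μ.real (⋃ S ∈ T, {G | neighborsIn G B v = S}) := measureReal_mono hsub (measure_ne_top _ _)
    _ ≤ ∑ S ∈ T, μ.real {G | neighborsIn G B v = S} := measureReal_biUnion_finset_le _ _
    _ ≤ ∑ S ∈ T, 2 * (p ^ #S * (1 - p) ^ (#B - #S)) :=
        sum_le_sum fun S hS => hμ S (mem_powerset.1 (mem_filter.1 hS).1)
    _ ≤ _ := by
        rw [← mul_sum]
        refine mul_le_mul_of_nonneg_left ?_ zero_le_two
        refine sum_le_of_pow_mul_pow_lt hp0 hp1 B hy ht T fun S hS => ?_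
        obtain ⟨h1, h2⟩ := mem_filter.1 hS
        exact ⟨mem_powerset.1 h1, not_le.1 h2⟩

lemma integral_card_exceptionalPairs_le {n s : ℕ} {μ : Measure (SimpleGraph (Fin n))}
    [IsFiniteMeasure μ] (T : Finset (Fin n) → Prop) {b : ℝ} (hb : 0 ≤ b)
    (h : ∀ v : Fin n, ∀ j < n / s, j < (v : ℕ) / s →
      μ.real {G | ¬ T (neighborsIn G (vertexBlock n s j) v)} ≤ b) :
    ∫ G, (#(exceptionalPairs s T G) : ℝ) ∂μ ≤ n * (n / s : ℕ) * b := by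
  classical
  set I : Finset (Fin n × ℕ) := {x ∈ univ ×ˢ range (n / s) | x.2 < (x.1 : ℕ) / s} with hI
  have hcard : ∀ G, (#(exceptionalPairs s T G) : ℝ) = ∑ x ∈ I,
      ({G | ¬ T (neighborsIn G (vertexBlock n s x.2) x.1)} : Set (SimpleGraph (Fin n))).indicator
        (1 : SimpleGraph (Fin n) → ℝ) G := by
    intro G
    simp only [Set.indicator_apply, Set.mem_ofPred_eq, Pi.one_apply, sum_boole]
    rw [exceptionalPairs, hI, filter_filter]
  simp only [hcard]
  rw [integral_finsetSum _ fun _ _ => integrable_of_simpleGraph _ _]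
  have hterm : ∀ x ∈ I, ∫ G, ({G | ¬ T (neighborsIn G (vertexBlock n s x.2) x.1)} :
      Set (SimpleGraph (Fin n))).indicator (1 : SimpleGraph (Fin n) → ℝ) G ∂μ ≤ b := by
    intro x hx
    rw [integral_indicator_one (MeasurableSet.of_discrete)]
    simp only [hI, mem_filter, mem_product, mem_univ, true_and, mem_range] at hx
    exact h x.1 x.2 hx.1 hx.2
  refine (sum_le_card_nsmul _ _ _ hterm).trans ?_
  rw [nsmul_eq_mul]
  refine mul_le_mul_of_nonneg_right ?_ hb
  have : #I ≤ n * (n / s) := (card_filter_le _ _).trans (by simp)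
  exact_mod_cast this

/-- The four terms are the costs of the vertex classes, the typical patterns, the edges inside
blocks and the edges of atypical patterns. In the last, about n² / s pairs each fail with
probability at most twice the tail bound and then cost at most 2s. -/
lemma integral_minPartitionWeight_le {n s : ℕ} (hs : 0 < s) {μ : Measure (SimpleGraph (Fin n))}
    [IsProbabilityMeasure μ] {p : ℝ} (hp0 : 0 < p) (hp1 : p < 1)
    (hμ : ∀ v : Fin n, ∀ B : Finset (Fin n), v ∉ B → #B = s → ∀ S ⊆ B,
      μ.real {G | neighborsIn G B v = S} ≤ 2 * (p ^ #S * (1 - p) ^ (#B - #S)))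
    {y t : ℝ} (hy : 0 < y) (ht : 0 ≤ t) :
    ∫ G, (minPartitionWeight G : ℝ) ∂μ ≤
      (n : ℝ) ^ 2 / (2 * s) + n * y⁻¹ + 2 * n * s +
        4 * n ^ 2 * ((p ^ (1 - t) + (1 - p) ^ (1 - t)) ^ s * y ^ t) := by
  classical
  have hq : 0 < 1 - p := by linarith
  set T : Finset (Fin n) → Prop := IsTypical p y s with hT
  set b := (p ^ (1 - t) + (1 - p) ^ (1 - t)) ^ s * y ^ t with hb
  have hb0 : 0 ≤ b := by positivity
  have hs0 : (0 : ℝ) < s := by exact_mod_cast hs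
  have hexc := integral_card_exceptionalPairs_le (μ := μ) (s := s) T (b := 2 * b) (by positivity) (by
    intro v j hj hjv
    have hc := card_vertexBlock hs hj
    have hv : v ∉ vertexBlock n s j := by simp only [mem_vertexBlock]; omega
    have := measureReal_not_isTypical_le hp0 hp1 (hμ v _ hv hc) hy ht
    rwa [hc] at this)
  have hns : ((n / s : ℕ) : ℝ) * s ≤ n := by exact_mod_cast Nat.div_mul_le_self n s
  have h1 : ((∑ v : Fin n, (v : ℕ) / s : ℕ) : ℝ) ≤ (n : ℝ) ^ 2 / (2 * s) := by
    push_cast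
    calc (∑ v : Fin n, (((v : ℕ) / s : ℕ) : ℝ)) ≤ ∑ v : Fin n, ((v : ℕ) : ℝ) / s :=
          sum_le_sum fun v _ => Nat.cast_div_le
      _ = (∑ i ∈ range n, (i : ℝ)) / s := by
          rw [← sum_div, Fin.sum_univ_eq_sum_range fun i => (i : ℝ)]
      _ ≤ _ := by
          rw [div_le_div_iff₀ hs0 (by positivity)]
          have h := sum_range_id_mul_two n
          have h' : (∑ i ∈ range n, (i : ℝ)) * 2 ≤ n * n := by
            have : (∑ i ∈ range n, i) * 2 ≤ n * n := h ▸ Nat.mul_le_mul_left _ (Nat.sub_le _ _)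
            rw [← Nat.cast_sum]; exact_mod_cast this
          nlinarith
  have h2 : (s : ℝ) * ((∑ j ∈ range (n / s), #{S ∈ (vertexBlock n s j).powerset | T S} : ℕ) : ℝ) ≤
      n * y⁻¹ := by
    have hj : ∀ j ∈ range (n / s), (#{S ∈ (vertexBlock n s j).powerset | T S} : ℝ) ≤ y⁻¹ := by
      intro j hj
      have hc := card_vertexBlock hs (mem_range.1 hj)
      refine card_le_of_pow_mul_pow_ge hp0 hp1 (vertexBlock n s j) hy _ fun S hS => ?_
      rw [hc]
      exact ⟨mem_powerset.1 (mem_filter.1 hS).1, (mem_filter.1 hS).2⟩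
    have := sum_le_card_nsmul _ _ _ hj
    rw [card_range, nsmul_eq_mul] at this
    push_cast
    have hy' : 0 < y⁻¹ := by positivity
    calc _ ≤ (s : ℝ) * ((n / s : ℕ) * y⁻¹) := by gcongr
      _ = ((n / s : ℕ) * s) * y⁻¹ := by ring
      _ ≤ _ := by gcongr
  set A : ℝ := ((∑ v : Fin n, (v : ℕ) / s : ℕ) : ℝ) with hA
  set C : ℝ := ((∑ j ∈ range (n / s), #{S ∈ (vertexBlock n s j).powerset | T S} : ℕ) : ℝ) with hC
  have hpt : ∀ G : SimpleGraph (Fin n), (minPartitionWeight G : ℝ) ≤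
      (A + s * C + 2 * (n * s)) + 2 * s * #(exceptionalPairs s T G) := by
    intro G
    have h := minPartitionWeight_le_of_blocks hs T G
    have h' : (minPartitionWeight G : ℝ) ≤ A + s * C +
        2 * (n * s + s * #(exceptionalPairs s T G)) := by
      rw [hA, hC]; exact_mod_cast h
    linarith
  have hint : ∫ G, (minPartitionWeight G : ℝ) ∂μ ≤ (A + s * C + 2 * (n * s)) +
      2 * s * ∫ G, (#(exceptionalPairs s T G) : ℝ) ∂μ := by
    refine (integral_mono (integrable_of_simpleGraph _ _) (integrable_of_simpleGraph _ _)
      hpt).trans_eq ?_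
    rw [integral_add (integrable_of_simpleGraph _ _) (integrable_of_simpleGraph _ _),
      integral_const_mul]
    simp
  have h3 : 2 * (s : ℝ) * ∫ G, (#(exceptionalPairs s T G) : ℝ) ∂μ ≤ 4 * n ^ 2 * b := by
    calc _ ≤ 2 * (s : ℝ) * (n * (n / s : ℕ) * (2 * b)) := by gcongr
      _ = 4 * n * b * ((n / s : ℕ) * s) := by ring
      _ ≤ 4 * n * b * n := by gcongr
      _ = _ := by ring
  linarith

end Expectation

/-! ### The block size s = ⌊c log n⌋. -/

section Asymptotics

/-- With `s = ⌊c log n⌋` the error terms of the block partition are negligible. -/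
lemma tendsto_block_bound {c a ρ : ℝ} (hc : 0 < c) (ha : 0 < a) (hca : c * a < 1) (hρ0 : 0 < ρ)
    (hρ1 : ρ < 1) :
    Tendsto (fun n : ℕ => ((n : ℝ) ^ 2 / (2 * ⌊c * Real.log n⌋₊) +
      n * Real.exp (a * ⌊c * Real.log n⌋₊) + 2 * n * ⌊c * Real.log n⌋₊ +
        4 * n ^ 2 * ρ ^ ⌊c * Real.log n⌋₊) / ((n : ℝ) ^ 2 / Real.log n)) atTop (𝓝 (1 / (2 * c))) := by
  have hlog : Tendsto (fun n : ℕ => Real.log n) atTop atTop :=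
    Real.tendsto_log_atTop.comp tendsto_natCast_atTop_atTop
  have hfl : Tendsto (fun n : ℕ => ((⌊c * Real.log n⌋₊ : ℕ) : ℝ) / Real.log n) atTop (𝓝 c) :=
    (tendsto_nat_floor_mul_div_atTop hc.le).comp hlog
  have t1 : Tendsto (fun n : ℕ => 1 / (2 * (((⌊c * Real.log n⌋₊ : ℕ) : ℝ) / Real.log n)))
      atTop (𝓝 (1 / (2 * c))) :=
    tendsto_const_nhds.div (hfl.const_mul 2) (by positivity)
  have hlogpow : ∀ r : ℝ, 0 < r → Tendsto (fun n : ℕ => Real.log n * (n : ℝ) ^ (-r)) atTop (𝓝 0) := by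
    intro r hr
    have h := (isLittleO_log_rpow_atTop hr).tendsto_div_nhds_zero.comp
      (tendsto_natCast_atTop_atTop (R := ℝ))
    refine h.congr fun n => ?_
    simp only [Function.comp_apply]
    rw [Real.rpow_neg (by positivity), div_eq_mul_inv]
  have t2 := hlogpow (1 - c * a) (by linarith)
  have t3 : Tendsto (fun n : ℕ => 2 * c * (Real.log n * (n : ℝ) ^ (-(1 / 2 : ℝ))) *
      (Real.log n * (n : ℝ) ^ (-(1 / 2 : ℝ)))) atTop (𝓝 0) := by
    have := ((hlogpow (1 / 2) (by norm_num)).const_mul (2 * c)).mul (hlogpow (1 / 2) (by norm_num))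
    simpa using this
  have hρl : Real.log ρ < 0 := Real.log_neg hρ0 hρ1
  -- The factor `ρ⁻¹` pays for the floor in the exponent of `ρ`.
  have t4 : Tendsto (fun n : ℕ => 4 * ρ⁻¹ * (Real.log n * (n : ℝ) ^ (-(-(c * Real.log ρ)))))
      atTop (𝓝 0) := by
    have := (hlogpow (-(c * Real.log ρ)) (by nlinarith)).const_mul (4 * ρ⁻¹)
    simpa using this
  have herr : Tendsto (fun n : ℕ => (n * Real.exp (a * ⌊c * Real.log n⌋₊) +
      2 * n * ⌊c * Real.log n⌋₊ + 4 * n ^ 2 * ρ ^ ⌊c * Real.log n⌋₊) / ((n : ℝ) ^ 2 / Real.log n))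
      atTop (𝓝 0) := by
    have tsum := (t2.add t3).add t4
    simp only [add_zero] at tsum
    refine squeeze_zero' ?_ ?_ tsum
    · filter_upwards [hlog.eventually_ge_atTop 1] with n hn
      positivity
    · filter_upwards [hlog.eventually_ge_atTop 1, eventually_gt_atTop 0] with n hn hn0
      have hn0 : (0 : ℝ) < n := by exact_mod_cast hn0
      set l := Real.log n with hl
      set s : ℝ := ((⌊c * l⌋₊ : ℕ) : ℝ) with hs
      have hs1 : s ≤ c * l := Nat.floor_le (by positivity)
      have hs2 : c * l - 1 ≤ s := (Nat.sub_one_lt_floor _).le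
      have hexp : ∀ r : ℝ, (n : ℝ) ^ r = Real.exp (r * l) := fun r => by
        rw [Real.rpow_def_of_pos hn0, mul_comm]
      have e1 : Real.exp (a * s) ≤ n * (n : ℝ) ^ (-(1 - c * a)) := by
        rw [hexp]
        nth_rewrite 1 [← Real.exp_log hn0]
        rw [← Real.exp_add]
        refine Real.exp_le_exp.2 ?_
        rw [← hl]
        nlinarith
      have e3 : (n : ℝ) ^ (-(1 / 2 : ℝ)) * (n : ℝ) ^ (-(1 / 2 : ℝ)) = (n : ℝ)⁻¹ := by
        rw [← Real.rpow_add hn0, ← Real.rpow_neg_one]; norm_num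
      have e4 : ρ ^ ⌊c * l⌋₊ ≤ ρ⁻¹ * (n : ℝ) ^ (-(-(c * Real.log ρ))) := by
        rw [hexp]
        nth_rewrite 2 [← Real.exp_log hρ0]
        rw [← Real.exp_neg, ← Real.exp_add, ← Real.rpow_natCast, Real.rpow_def_of_pos hρ0]
        refine Real.exp_le_exp.2 ?_
        rw [← hs]
        nlinarith
      have hl0 : 0 < l := by linarith
      rw [div_le_iff₀ (by positivity)]
      have r1 : l * (n : ℝ) ^ (-(1 - c * a)) * (n ^ 2 / l) = n * (n * (n : ℝ) ^ (-(1 - c * a))) := by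
        field_simp
      have r3 : 2 * c * (l * (n : ℝ) ^ (-(1 / 2 : ℝ))) * (l * (n : ℝ) ^ (-(1 / 2 : ℝ))) * (n ^ 2 / l) =
          2 * n * (c * l) := by
        calc _ = 2 * c * l * n ^ 2 * ((n : ℝ) ^ (-(1 / 2 : ℝ)) * (n : ℝ) ^ (-(1 / 2 : ℝ))) := by
              field_simp
          _ = _ := by rw [e3]; field_simp
      have r4 : 4 * ρ⁻¹ * (l * (n : ℝ) ^ (-(-(c * Real.log ρ)))) * (n ^ 2 / l) =
          4 * n ^ 2 * (ρ⁻¹ * (n : ℝ) ^ (-(-(c * Real.log ρ)))) := by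
        field_simp
      rw [add_mul, add_mul, r1, r3, r4]
      gcongr
  have := t1.add herr
  rw [add_zero] at this
  refine this.congr' ?_
  filter_upwards [hlog.eventually_ge_atTop 1, eventually_gt_atTop 0,
    hfl.eventually_const_lt hc] with n hn hn0 hf
  have hn0 : (0 : ℝ) < n := by exact_mod_cast hn0
  have hl0 : 0 < Real.log n := by linarith
  have hs0 : (0 : ℝ) < ⌊c * Real.log n⌋₊ := by
    by_contra h
    have : ((⌊c * Real.log n⌋₊ : ℕ) : ℝ) / Real.log n ≤ 0 :=
      div_nonpos_of_nonpos_of_nonneg (not_lt.1 h) hl0.le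
    linarith
  rw [add_assoc ((n : ℝ) ^ 2 / _), add_assoc ((n : ℝ) ^ 2 / _), add_div ((n : ℝ) ^ 2 / _),
    add_assoc (_ * Real.exp _)]
  congr 1
  field_simp

end Asymptotics

/-! ### Both models satisfy the same two estimates. -/

section Models

/-- The two properties of a random graph model that determine its biclique weights: neighbourhood
patterns are at most about as likely as in the binomial model, and no small set of graphs is
likely. -/
structure IsEntropicModel (p : ℝ) (μ : (n : ℕ) → Measure (SimpleGraph (Fin n))) : Prop where
  isProbabilityMeasure : ∀ n, IsProbabilityMeasure (μ n)
  pattern_le : ∀ s : ℕ → ℕ, (∀ᶠ n in atTop, 4 * s n ≤ n) → ∀ᶠ n in atTop,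
    ∀ v : Fin n, ∀ B : Finset (Fin n), v ∉ B → #B = s n → ∀ S ⊆ B,
      (μ n).real {G | neighborsIn G B v = S} ≤ 2 * (p ^ #S * (1 - p) ^ (#B - #S))
  real_le : ∀ ε > 0, ∃ r : ℕ → ℝ, Tendsto r atTop (𝓝 0) ∧ ∀ᶠ n in atTop,
    ∀ P : SimpleGraph (Fin n) → Prop, (μ n).real {G | P G} ≤
      {G : SimpleGraph (Fin n) | P G}.ncard * Real.exp (-(Real.binEntropy p - ε) * n.choose 2) + r n

lemma tendsto_choose_two_atTop : Tendsto (fun n : ℕ => n.choose 2) atTop atTop := by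
  refine tendsto_atTop_mono' atTop ?_ (tendsto_sub_atTop_nat 1)
  filter_upwards [eventually_ge_atTop 2] with n hn
  rw [Nat.choose_two_right, Nat.le_div_iff_mul_le two_pos, mul_comm]
  exact Nat.mul_le_mul_right _ hn

lemma isEntropicModel_binomialRandom {p : ℝ} (hp0 : 0 < p) (hp1 : p < 1) :
    IsEntropicModel p fun n => SimpleGraph.binomialRandom (Fin n) ⟨p, hp0.le, hp1.le⟩ where
  isProbabilityMeasure n := inferInstance
  pattern_le s hs := by
    filter_upwards [hs, eventually_ge_atTop 2]
      with n hn hn2 v B hv hB S hS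
    have hq : 0 < 1 - p := by linarith
    have hle : #B ≤ (Fintype.card (Fin n)).choose 2 := by
      rw [Fintype.card_fin, hB, Nat.choose_two_right, Nat.le_div_iff_mul_le two_pos]
      have : n * 1 ≤ n * (n - 1) := Nat.mul_le_mul_left _ (by omega)
      omega
    refine (binomialRandom_real_neighborsIn_le hp0 hp1 hv hS hle).trans ?_
    have : 0 ≤ p ^ #S * (1 - p) ^ (#B - #S) := by positivity
    linarith
  real_le ε hε := by
    have hq : 0 < 1 - p := by linarith
    obtain ⟨t, ht, hlt⟩ := exists_pos_moment_lt_one hp0 hp1 hε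
    refine ⟨_, (tendsto_pow_atTop_nhds_zero_of_lt_one (by positivity) hlt).comp
      tendsto_choose_two_atTop, Eventually.of_forall fun n P => ?_⟩
    simpa using binomialRandom_real_le hp0 hp1 (ε := ε) ht P

lemma isEntropicModel_uniformRandomGraph {p : ℝ} (hp0 : 0 < p) (hp1 : p < 1) :
    IsEntropicModel p fun n => uniformRandomGraph n ⌊p * (n.choose 2 : ℝ)⌋₊ := by
  have hfloor : ∀ N : ℕ, ⌊p * (N : ℝ)⌋₊ ≤ N := fun N =>
    Nat.floor_le_of_le (mul_le_of_le_one_left (by positivity) hp1.le)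
  have hq : 0 < 1 - p := by linarith
  refine ⟨fun n => isProbabilityMeasure_uniformRandomGraph (hfloor _), fun s hs => ?_,
    fun ε hε => ⟨fun _ => 0, tendsto_const_nhds, ?_⟩⟩
  · filter_upwards [hs, eventually_ge_atTop 2,
      -- With #B ≤ n/4 and C(n, 2) ≥ n²/4, the size condition reduces to (1 - p) n ≥ 4 + 2 (1 - p),
      -- which is this threshold.
      tendsto_natCast_atTop_atTop.eventually_ge_atTop (2 * (3 - p) / (1 - p))]
      with n hn hn2 hnp v B hv hB S hS
    have hn2' : (2 : ℝ) ≤ n := by exact_mod_cast hn2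
    have hsn : 4 * (#B : ℝ) ≤ n := by rw [hB]; exact_mod_cast hn
    have hB0 : (0 : ℝ) ≤ #B := by positivity
    have hN : (n : ℝ) ^ 2 / 4 ≤ (n.choose 2 : ℕ) := by
      rw [Nat.cast_choose_two]; nlinarith
    refine uniformRandomGraph_real_neighborsIn_le hp0 hp1 hv hS ?_ ?_
    · have : (#B : ℝ) < (n.choose 2 : ℕ) := by nlinarith
      exact_mod_cast this
    · rw [div_le_iff₀ hq] at hnp
      have h1 : 2 * (#B : ℝ) * ((1 - p) * #B + 1) ≤ 2 * (n / 4) * ((1 - p) * (n / 4) + 1) := by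
        have : (#B : ℝ) ≤ n / 4 := by linarith
        gcongr
      have h2 : (1 - p) * ((n : ℝ) ^ 2 / 4 - n / 4) ≤ (1 - p) * ((n.choose 2 : ℕ) - #B) := by
        gcongr; linarith
      refine h1.trans (le_trans ?_ h2)
      nlinarith
  · filter_upwards [tendsto_choose_two_atTop.eventually (eventually_exp_le_choose hp0 hp1 hε)]
      with n hn P
    refine (uniformRandomGraph_real_le (hfloor _) P).trans ?_
    rw [add_zero, neg_mul, Real.exp_neg, ← div_eq_mul_inv]
    gcongr
    exacts [Set.toFinite _, fun h => h.2]

end Models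

/-! ### Concentration and expectations. -/

section Main

/-- The common order of magnitude of the biclique weights, in natural logarithms. -/
noncomputable def bicliqueScale (p : ℝ) (n : ℕ) : ℝ :=
  Real.binEntropy p / 2 * ((n : ℝ) ^ 2 / Real.log n)

lemma bicliqueScale_eq (p : ℝ) (n : ℕ) :
    binaryEntropy p / 2 * ((n : ℝ) ^ 2 / Real.logb 2 (n : ℝ)) = bicliqueScale p n := by
  have h2 : Real.log 2 ≠ 0 := by positivity
  rw [bicliqueScale, binaryEntropy, Real.binEntropy, Real.logb, Real.logb, Real.logb,
    Real.log_inv, Real.log_inv]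
  -- For `n ≤ 1` both sides vanish, division by zero being zero.
  by_cases h : Real.log n = 0
  · simp [h]
  · field_simp
    ring

lemma eventually_bicliqueScale_pos {p : ℝ} (hp0 : 0 < p) (hp1 : p < 1) :
    ∀ᶠ n in atTop, 0 < bicliqueScale p n := by
  filter_upwards [eventually_ge_atTop 2] with n hn
  have h1 : 0 < Real.binEntropy p := Real.binEntropy_pos hp0 hp1
  have h2 : 0 < Real.log n := Real.log_pos (by exact_mod_cast hn)
  have h3 : (0 : ℝ) < n := by positivity
  rw [bicliqueScale]
  positivity

variable {p : ℝ} {μ : (n : ℕ) → Measure (SimpleGraph (Fin n))}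

lemma tendsto_measure_minCoverWeight_lt (hp0 : 0 < p) (hp1 : p < 1) (hμ : IsEntropicModel p μ)
    {ε : ℝ} (hε : 0 < ε) (hε1 : ε < 1) :
    Tendsto (fun n => (μ n).real {G | (minCoverWeight G : ℝ) < (1 - ε) * bicliqueScale p n}) atTop
      (𝓝 0) := by
  have hH : 0 < Real.binEntropy p := Real.binEntropy_pos hp0 hp1
  set H := Real.binEntropy p with hHdef
  -- Half of the entropy gap is spent here; the other half leaves an exponent of at most -(εH/4) n²
  -- + (H/2) n, the linear term coming from C(n, 2) = (n² - n) / 2.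
  obtain ⟨r, hr, hreal⟩ := hμ.real_le (ε * H / 2) (by positivity)
  have hexp : Tendsto (fun n : ℕ => Real.exp (Real.exp 2) *
      Real.exp (-(ε * H / 4 * (n : ℝ) + -(H / 2)) * n)) atTop (𝓝 0) := by
    have h1 : Tendsto (fun n : ℕ => (ε * H / 4 * (n : ℝ) + -(H / 2)) * n) atTop atTop :=
      (tendsto_atTop_add_const_right _ _
        (tendsto_natCast_atTop_atTop.const_mul_atTop (by positivity))).atTop_mul_atTop₀
        tendsto_natCast_atTop_atTop
    have := (Real.tendsto_exp_neg_atTop_nhds_zero.comp h1).const_mul (Real.exp (Real.exp 2))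
    simpa only [mul_zero, Function.comp_def, neg_mul] using this
  refine squeeze_zero' (Eventually.of_forall fun n => measureReal_nonneg) ?_
    (by simpa only [add_zero] using hexp.add hr)
  filter_upwards [hreal, eventually_ge_atTop 2, eventually_bicliqueScale_pos hp0 hp1]
    with n hn hn2 hLpos
  have hn0 : (0 : ℝ) < n := by positivity
  have hlog : 0 < Real.log n := Real.log_pos (by exact_mod_cast hn2)
  have hnonempty : Nonempty (Fin n) := ⟨⟨0, by omega⟩⟩
  refine (hn _).trans (add_le_add_left ?_ _)
  set w := ⌊(1 - ε) * bicliqueScale p n⌋₊ with hw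
  have hx0 : 0 ≤ (1 - ε) * bicliqueScale p n := by
    have : 0 < 1 - ε := by linarith
    positivity
  have hwle : (w : ℝ) ≤ (1 - ε) * bicliqueScale p n := Nat.floor_le hx0
  have hcount : ({G : SimpleGraph (Fin n) | (minCoverWeight G : ℝ) <
      (1 - ε) * bicliqueScale p n}.ncard : ℝ) ≤ (n : ℝ) ^ w * Real.exp (Real.exp 2) := by
    have h := ncard_minCoverWeight_le (V := Fin n) w
    rw [Fintype.card_fin] at h
    refine le_trans ?_ h
    have hsub : {G : SimpleGraph (Fin n) | (minCoverWeight G : ℝ) < (1 - ε) * bicliqueScale p n} ⊆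
        {G | minCoverWeight G ≤ w} := fun G hG => Nat.le_floor (le_of_lt hG)
    exact_mod_cast Set.ncard_le_ncard hsub (Set.toFinite _)
  have hpow : (n : ℝ) ^ w ≤ Real.exp ((1 - ε) * H / 2 * n ^ 2) := by
    rw [← Real.rpow_natCast, Real.rpow_def_of_pos hn0]
    refine Real.exp_le_exp.2 ((mul_le_mul_of_nonneg_left hwle hlog.le).trans_eq ?_)
    rw [bicliqueScale, ← hHdef]
    field_simp
  calc _ ≤ (Real.exp ((1 - ε) * H / 2 * n ^ 2) * Real.exp (Real.exp 2)) *
        Real.exp (-(H - ε * H / 2) * n.choose 2) := by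
        gcongr
        exact hcount.trans (by gcongr)
    _ = Real.exp (Real.exp 2) * (Real.exp ((1 - ε) * H / 2 * n ^ 2) *
        Real.exp (-(H - ε * H / 2) * n.choose 2)) := by ring
    _ ≤ _ := by
        rw [← Real.exp_add, Nat.cast_choose_two]
        refine mul_le_mul_of_nonneg_left (Real.exp_le_exp.2 ?_) (Real.exp_pos _).le
        have : 0 < ε * H * n := by positivity
        nlinarith

lemma eventually_integral_minPartitionWeight_le (hp0 : 0 < p) (hp1 : p < 1)
    (hμ : IsEntropicModel p μ) {ε : ℝ} (hε : 0 < ε) :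
    ∀ᶠ n in atTop, ∫ G, (minPartitionWeight G : ℝ) ∂(μ n) ≤ (1 + ε) * bicliqueScale p n := by
  have hH : 0 < Real.binEntropy p := Real.binEntropy_pos hp0 hp1
  have hq : 0 < 1 - p := by linarith
  set H := Real.binEntropy p with hHdef
  obtain ⟨t, ht, hlt⟩ := exists_neg_moment_lt_one hp0 hp1 (ε := ε * H / 4) (by positivity)
  set a := H + ε * H / 4 with ha
  set ρ := (p ^ (1 - t) + (1 - p) ^ (1 - t)) * Real.exp (-t * a) with hρ
  have hρ0 : 0 < ρ := by positivity
  -- The typicality rate `a` exceeds `H` by a factor 1 + ε/4 and 1 / c exceeds `H` by 1 + ε/2. Thus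
  -- `c * a < 1` keeps the typical patterns cheap, while the main term 1 / (2c) stays below (1 + ε)
  -- H / 2.
  set c := 1 / (H * (1 + ε / 2)) with hc
  have hc0 : 0 < c := by positivity
  have hca : c * a < 1 := by
    rw [hc, ha, one_div, inv_mul_lt_iff₀ (by positivity)]
    nlinarith [mul_pos hε hH]
  have hlim := tendsto_block_bound hc0 (by positivity) hca hρ0 hlt
  have hlog : Tendsto (fun n : ℕ => Real.log n) atTop atTop :=
    Real.tendsto_log_atTop.comp tendsto_natCast_atTop_atTop
  have hsmall : ∀ᶠ n : ℕ in atTop, 4 * ⌊c * Real.log n⌋₊ ≤ n := by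
    have h := (Real.isLittleO_log_id_atTop.comp_tendsto
      (tendsto_natCast_atTop_atTop (R := ℝ))).bound (c := 1 / (4 * c)) (by positivity)
    filter_upwards [h, hlog.eventually_ge_atTop 0] with n hn hl
    simp only [Function.comp_apply, id_eq, Real.norm_eq_abs, abs_of_nonneg hl, Nat.abs_cast] at hn
    have h1 : ((⌊c * Real.log n⌋₊ : ℕ) : ℝ) ≤ c * Real.log n := Nat.floor_le (by positivity)
    have h2 : 4 * (c * Real.log n) ≤ n := by
      calc 4 * (c * Real.log n) ≤ 4 * (c * (1 / (4 * c) * n)) := by gcongr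
        _ = n := by field_simp
    have : 4 * ((⌊c * Real.log n⌋₊ : ℕ) : ℝ) ≤ n := by linarith
    exact_mod_cast this
  have hpos : ∀ᶠ n : ℕ in atTop, 0 < ⌊c * Real.log n⌋₊ := by
    filter_upwards [(hlog.const_mul_atTop hc0).eventually_ge_atTop 1] with n hn
    exact Nat.floor_pos.2 hn
  have hconst : 1 / (2 * c) < (1 + ε) * (H / 2) := by
    rw [hc]; field_simp; linarith
  filter_upwards [hlim.eventually_lt_const hconst, hsmall, hpos, hμ.pattern_le _ hsmall,
    hlog.eventually_gt_atTop 0, eventually_gt_atTop 0] with n h1 h2 h3 h4 h5 h6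
  have := hμ.isProbabilityMeasure n
  have hn0 : (0 : ℝ) < n := by exact_mod_cast h6
  have hint := integral_minPartitionWeight_le h3 hp0 hp1 h4
    (y := Real.exp (-(a * ⌊c * Real.log n⌋₊))) (Real.exp_pos _) ht.le
  have e1 : (Real.exp (-(a * ⌊c * Real.log n⌋₊)))⁻¹ = Real.exp (a * ⌊c * Real.log n⌋₊) := by
    rw [Real.exp_neg, inv_inv]
  have e2 : (p ^ (1 - t) + (1 - p) ^ (1 - t)) ^ ⌊c * Real.log n⌋₊ *
      Real.exp (-(a * ⌊c * Real.log n⌋₊)) ^ t = ρ ^ ⌊c * Real.log n⌋₊ := by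
    rw [hρ, mul_pow, ← Real.exp_nat_mul, ← Real.exp_mul]
    congr 2; ring
  rw [e1, e2] at hint
  rw [div_lt_iff₀ (by positivity)] at h1
  refine hint.trans (h1.le.trans_eq ?_)
  rw [bicliqueScale]; ring

/-- No second moment is needed: the mean barely exceeds the lower bound that holds with high
probability, which leaves no room for frequent large values. -/
lemma tendsto_measure_minPartitionWeight_gt (hp0 : 0 < p) (hp1 : p < 1)
    (hμ : IsEntropicModel p μ) {ε : ℝ} (hε : 0 < ε) :
    Tendsto (fun n => (μ n).real {G | (1 + ε) * bicliqueScale p n < minPartitionWeight G}) atTop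
      (𝓝 0) := by
  rw [Metric.tendsto_atTop']
  intro η hη
  set δ := min (1 / 2) (ε * η / 8) with hδ
  have hδ0 : 0 < δ := by positivity
  have hδ1 : δ ≤ 1 / 2 := min_le_left _ _
  have hδ2 : δ ≤ ε * η / 8 := min_le_right _ _
  have hlow := (tendsto_measure_minCoverWeight_lt hp0 hp1 hμ hδ0 (by linarith)).eventually_lt_const
    (show 0 < ε * η / 4 by positivity)
  obtain ⟨n₀, hn₀⟩ := eventually_atTop.1 ((hlow.and
    (eventually_integral_minPartitionWeight_le hp0 hp1 hμ hδ0)).and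
      (eventually_bicliqueScale_pos hp0 hp1))
  refine ⟨n₀, fun n hn => ?_⟩
  obtain ⟨⟨h1, h2⟩, hL⟩ := hn₀ n hn.le
  have := hμ.isProbabilityMeasure n
  rw [dist_zero_right, Real.norm_eq_abs, abs_of_nonneg measureReal_nonneg]
  set L := bicliqueScale p n with hLdef
  set A := {G : SimpleGraph (Fin n) | (minCoverWeight G : ℝ) < (1 - δ) * L} with hA
  set B := {G : SimpleGraph (Fin n) | (1 + ε) * L < minPartitionWeight G} with hB
  -- Integrating yields (ε + δ) μ(B) ≤ 2δ + (1 - δ) μ(A); with δ ≤ εη/8 and μ(A) < εη/4 the right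
  -- side is below εη.
  have hpt : ∀ G : SimpleGraph (Fin n), (1 - δ) * L - (1 - δ) * L * A.indicator 1 G +
      (ε + δ) * L * B.indicator 1 G ≤ (minPartitionWeight G : ℝ) := by
    intro G
    have hle : (minCoverWeight G : ℝ) ≤ minPartitionWeight G := by
      exact_mod_cast minCoverWeight_le_minPartitionWeight G
    have hpos : 0 ≤ (1 - δ) * L := mul_nonneg (by linarith) hL.le
    have hnn : (0 : ℝ) ≤ minPartitionWeight G := by positivity
    by_cases hGA : G ∈ A <;> by_cases hGB : G ∈ B <;>
      simp only [Set.indicator_of_mem, Set.indicator_of_notMem, hGA, hGB, not_false_eq_true,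
        Pi.one_apply, mul_one, mul_zero] <;>
      simp only [hA, hB, Set.mem_ofPred_eq, not_lt] at hGA hGB <;> nlinarith
  have hint := integral_mono (integrable_of_simpleGraph (μ n) _)
    (integrable_of_simpleGraph (μ n) _) hpt
  rw [integral_add (integrable_of_simpleGraph _ _) (integrable_of_simpleGraph _ _),
    integral_sub (integrable_of_simpleGraph _ _) (integrable_of_simpleGraph _ _),
    integral_const, probReal_univ, one_smul, integral_const_mul, integral_const_mul,
    integral_indicator_one MeasurableSet.of_discrete, integral_indicator_one MeasurableSet.of_discrete] at hint
  have hA0 : 0 ≤ (μ n).real A := measureReal_nonneg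
  have hB0 : 0 ≤ (μ n).real B := measureReal_nonneg
  have hkey : (ε + δ) * (μ n).real B * L ≤ (2 * δ + (1 - δ) * (μ n).real A) * L := by linarith
  have hkey' := le_of_mul_le_mul_right hkey hL
  have : (1 - δ) * (μ n).real A ≤ (μ n).real A := mul_le_of_le_one_left hA0 (by linarith)
  have : ε * (μ n).real B ≤ (ε + δ) * (μ n).real B := by gcongr; linarith
  have : ε * (μ n).real B < ε * η := by
    have : 0 < ε * η := by positivity
    linarith
  exact lt_of_mul_lt_mul_left this hε.le

/-- Events whose failure forces the lower or the upper estimate to fail have probability tending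
to one. -/
lemma tendsto_measure_one_of_estimates (hp0 : 0 < p) (hp1 : p < 1) (hμ : IsEntropicModel p μ)
    {δ : ℝ} (hδ0 : 0 < δ) (hδ1 : δ < 1) (P : (n : ℕ) → SimpleGraph (Fin n) → Prop)
    (hP : ∀ n G, 0 < bicliqueScale p n → (1 - δ) * bicliqueScale p n ≤ minCoverWeight G →
      (minPartitionWeight G : ℝ) ≤ (1 + δ) * bicliqueScale p n → P n G) :
    Tendsto (fun n => μ n {G | P n G}) atTop (𝓝 1) := by
  have hfin : ∀ n, IsProbabilityMeasure (μ n) := hμ.isProbabilityMeasure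
  rw [← ENNReal.tendsto_toReal_iff (fun n => measure_ne_top _ _) ENNReal.one_ne_top,
    ENNReal.toReal_one]
  have hlim := (tendsto_measure_minCoverWeight_lt hp0 hp1 hμ hδ0 hδ1).add
    (tendsto_measure_minPartitionWeight_gt hp0 hp1 hμ hδ0)
  have hlim' := hlim.const_sub 1
  rw [add_zero, sub_zero] at hlim'
  refine tendsto_of_tendsto_of_tendsto_of_le_of_le' hlim' tendsto_const_nhds ?_
    (Eventually.of_forall fun n => measureReal_le_one)
  filter_upwards [eventually_bicliqueScale_pos hp0 hp1] with n hL
  have hsub : ({G | P n G} : Set (SimpleGraph (Fin n)))ᶜ ⊆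
      {G | (minCoverWeight G : ℝ) < (1 - δ) * bicliqueScale p n} ∪
      {G | (1 + δ) * bicliqueScale p n < minPartitionWeight G} := by
    intro G hG
    by_contra h
    simp only [Set.mem_union, Set.mem_ofPred_eq, not_or, not_lt] at h
    exact hG (hP n G hL h.1 h.2)
  have h1 := (measureReal_mono hsub (measure_ne_top (μ n) _)).trans (measureReal_union_le _ _)
  rw [probReal_compl_eq_one_sub MeasurableSet.of_discrete] at h1
  change _ ≤ (μ n).real _
  linarith

lemma isEquivalent_integral_bicliqueScale (hp0 : 0 < p) (hp1 : p < 1) (hμ : IsEntropicModel p μ)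
    (X : (n : ℕ) → SimpleGraph (Fin n) → ℝ) (hX : ∀ n G, (minCoverWeight G : ℝ) ≤ X n G)
    (hX' : ∀ n G, X n G ≤ minPartitionWeight G) :
    Asymptotics.IsEquivalent atTop (fun n => ∫ G, X n G ∂(μ n)) (bicliqueScale p) := by
  rw [Asymptotics.IsEquivalent, Asymptotics.isLittleO_iff]
  intro ε hε
  -- The lower bound loses δL twice: through the factor 1 - δ and on the exceptional event `A`.
  set δ := min (1 / 2) (ε / 2) with hδ
  have hδ0 : 0 < δ := by positivity
  have hδ1 : δ ≤ 1 / 2 := min_le_left _ _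
  have hδ2 : δ ≤ ε / 2 := min_le_right _ _
  filter_upwards [(tendsto_measure_minCoverWeight_lt hp0 hp1 hμ hδ0
      (by linarith)).eventually_lt_const hδ0,
    eventually_integral_minPartitionWeight_le hp0 hp1 hμ hδ0,
    eventually_bicliqueScale_pos hp0 hp1] with n h1 h2 hL
  have := hμ.isProbabilityMeasure n
  set L := bicliqueScale p n with hLdef
  set A := {G : SimpleGraph (Fin n) | (minCoverWeight G : ℝ) < (1 - δ) * L} with hA
  have hupper : ∫ G, X n G ∂(μ n) ≤ (1 + δ) * L :=
    (integral_mono (integrable_of_simpleGraph _ _) (integrable_of_simpleGraph _ _) (hX' n)).trans h2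
  have hpt : ∀ G : SimpleGraph (Fin n), (1 - δ) * L - (1 - δ) * L * A.indicator 1 G ≤ X n G := by
    intro G
    refine le_trans ?_ (hX n G)
    by_cases hGA : G ∈ A
    · simp [hGA]
    · simp only [Set.indicator_of_notMem hGA, mul_zero, sub_zero]
      exact not_lt.1 hGA
  have hint := integral_mono (integrable_of_simpleGraph (μ n) _)
    (integrable_of_simpleGraph (μ n) _) hpt
  rw [integral_sub (integrable_of_simpleGraph _ _) (integrable_of_simpleGraph _ _),
    integral_const, probReal_univ, one_smul, integral_const_mul,
    integral_indicator_one MeasurableSet.of_discrete] at hint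
  have hA0 : 0 ≤ (μ n).real A := measureReal_nonneg
  have h3 : (1 - δ) * L * (μ n).real A ≤ L * δ :=
    mul_le_mul (mul_le_of_le_one_left hL.le (by linarith)) h1.le hA0 hL.le
  have h4 : δ * L ≤ ε / 2 * L := by gcongr
  simp only [Pi.sub_apply, Real.norm_eq_abs]
  rw [abs_of_pos hL, abs_le]
  constructor <;> linarith

end Main

theorem mainTheorem5 (p : ℝ) (hp0 : 0 < p) (hp1 : p < 1)
    (μ : (n : ℕ) → MeasureTheory.Measure (SimpleGraph (Fin n)))
    (hμ : (∀ n : ℕ, μ n = uniformRandomGraph n ⌊p * (n.choose 2 : ℝ)⌋₊) ∨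
      (∀ n : ℕ, μ n = SimpleGraph.binomialRandom (Fin n) ⟨p, hp0.le, hp1.le⟩)) :
    AsymptoticWhp μ (fun _ G => (minCoverWeight G : ℝ)) (fun _ G => (minPartitionWeight G : ℝ)) ∧
    AsymptoticWhp μ (fun _ G => (minPartitionWeight G : ℝ))
      (fun n _ => binaryEntropy p / 2 * ((n : ℝ) ^ 2 / Real.logb 2 (n : ℝ))) ∧
    Asymptotics.IsEquivalent Filter.atTop
      (fun n : ℕ => ∫ G, (minCoverWeight G : ℝ) ∂(μ n))
      (fun n : ℕ => ∫ G, (minPartitionWeight G : ℝ) ∂(μ n)) ∧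
    Asymptotics.IsEquivalent Filter.atTop
      (fun n : ℕ => ∫ G, (minPartitionWeight G : ℝ) ∂(μ n))
      (fun n : ℕ => binaryEntropy p / 2 * ((n : ℝ) ^ 2 / Real.logb 2 (n : ℝ))) := by
  have hmodel : IsEntropicModel p μ := by
    rcases hμ with h | h
    · exact (funext h : μ = _) ▸ isEntropicModel_uniformRandomGraph hp0 hp1
    · exact (funext h : μ = _) ▸ isEntropicModel_binomialRandom hp0 hp1
  have hle : ∀ (n : ℕ) (G : SimpleGraph (Fin n)),
      (minCoverWeight G : ℝ) ≤ minPartitionWeight G := fun n G => by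
    exact_mod_cast minCoverWeight_le_minPartitionWeight G
  simp only [bicliqueScale_eq]
  have hbc := isEquivalent_integral_bicliqueScale hp0 hp1 hmodel
    (fun _ G => (minCoverWeight G : ℝ)) (fun _ _ => le_rfl) hle
  have hbp := isEquivalent_integral_bicliqueScale hp0 hp1 hmodel
    (fun _ G => (minPartitionWeight G : ℝ)) hle (fun _ _ => le_rfl)
  refine ⟨fun ε hε => ?_, fun ε hε => ?_, hbc.trans hbp.symm, hbp⟩
  · have hδ1 : min (1 / 2) (ε / 4) ≤ 1 / 2 := min_le_left _ _
    have hδ2 : min (1 / 2) (ε / 4) ≤ ε / 4 := min_le_right _ _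
    refine tendsto_measure_one_of_estimates hp0 hp1 hmodel (δ := min (1 / 2) (ε / 4))
      (by positivity) (by linarith) _ fun n G hL h1 h2 => ?_
    set δ := min (1 / 2) (ε / 4)
    have h3 := hle n G
    rw [abs_of_nonpos (by linarith), abs_of_nonneg (by positivity)]
    -- The error is relative to bp itself, which is at least L/2, while bp - bc ≤ 2δL ≤ εL/2.
    have h4 : ε * ((1 / 2) * bicliqueScale p n) ≤ ε * minPartitionWeight G := by
      gcongr
      nlinarith
    nlinarith
  · have hδ1 : min (1 / 2) ε ≤ 1 / 2 := min_le_left _ _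
    have hδ2 : min (1 / 2) ε ≤ ε := min_le_right _ _
    refine tendsto_measure_one_of_estimates hp0 hp1 hmodel (δ := min (1 / 2) ε)
      (by positivity) (by linarith) _ fun n G hL h1 h2 => ?_
    have h3 := hle n G
    rw [abs_of_pos hL, abs_le]
    constructor <;> nlinarith
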